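/- Let $f\in L^2(0,\infty;dx)$ be complex-valued, and for $\Lambda>0$, $x>0$ put $$A_\Lambda(x)=\sum_{n\ge 1,\ nx\le\Lambda} f(nx)-\frac1x\int_0^\Lambda f(t)\,dt .$$ A locally integrable function on $\mathbb R$ is said to be a tempered distribution $T$ if integration against it agrees with $T$ on $C^\infty$ functions with compact support. Let $\hat f(\tfrac12+i\tau)\in L^2(\mathbb R,d\tau)$ be the Mellin–Plancherel transform of $f$, that is, the limit in $L^2(d\tau)$ of $\int_a^A f(x)x^{-\frac12+i\tau}\,dx$ as $a\to0^+$, $A\to\infty$ (this limit exists). Then: 1. For every $\Lambda>0$ the function $\sqrt x\,A_\Lambda(x)$, as a function of $u=\log x\in\mathbb R$, is locally integrable and is a tempered distribution. As $\Lambda\to\infty$ these tempered distributions in $\log x$ converge, in the sense of tempered distributions, to a tempered distribution in $\log x$ of the form $\sqrt x\,D_f(x)$, where $D_f$ is a distribution on $]0,\infty[$. 2. In the sense of tempered distributions in $\log x$ and in $\tau$, $$\int_0^\infty \sqrt x\,D_f(x)\,x^{i\tau}\,\frac{dx}{x}=\zeta(\tfrac12+i\tau)\,\hat f(\tfrac12+i\tau),$$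 i.e. the Fourier transform, with kernel $e^{i\tau u}$ ($u=\log x$), of the tempered distribution $\sqrt x\,D_f(x)$ is the locally integrable function on the right. 3. $D_f$ is the unique distribution on $]0,\infty[$ such that, for every $C^\infty$ function $\phi$ with compact support in $]0,\infty[$, $$\int_0^\infty D_f(x)\phi(x)\,dx=\int_0^\infty f(x)\Big(\sum_{n\ge1}\frac{\phi(x/n)}n-\int_0^\infty\frac{\phi(1/t)}t\,dt\Big)dx,$$ where the outer integral on the right converges absolutely. 4. For every $x>0$ the integral $G(x)=\int_0^\infty f(xu)\frac{\{u\}}u\,du$ converges absolutely ($\{u\}$ is the fractional part of $u$), $G$ is locally integrable on $]0,\infty[$, and $D_f(x)=x\,\frac{d}{dx}G(x)$ in the sense of distributions on $]0,\infty[$. -/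

import Mathlib

open MeasureTheory Set Filter Topology
open scoped SchwartzMap Distributions FourierTransform ContDiff

noncomputable section

namespace Muntz

/-- The open half-line `]0, ∞[`. -/
def halfLine : TopologicalSpace.Opens ℝ := ⟨Ioi 0, isOpen_Ioi⟩

/-- Complex distributions on `]0, ∞[`: continuous linear forms on the space of complex-valued
`C^∞` functions with compact support in `]0, ∞[`. -/
abbrev HalfLineDistribution : Type := 𝓓(halfLine, ℂ) →L[ℂ] ℂ

/-- The truncated modified sum `A_Λ(x) = ∑_{n ≥ 1, n x ≤ Λ} f(n x) - (∫_0^Λ f(t) dt) / x`, for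
`x > 0`; the condition `n x ≤ Λ` is `n ≤ ⌊Λ / x⌋`. -/
def truncSum (f : ℝ → ℂ) (Λ x : ℝ) : ℂ :=
  ∑ n ∈ Finset.Icc 1 ⌊Λ / x⌋₊, f (n * x) - (∫ t in (0 : ℝ)..Λ, f t) / (x : ℂ)

/-- The locally integrable function `g` on `ℝ` is a tempered distribution, namely `T`: the linear
form `ψ ↦ ∫ g ψ` on smooth compactly supported functions is the restriction of the (necessarily
unique) tempered distribution `T`. -/
def IsTemperedFun (g : ℝ → ℂ) (T : 𝓢'(ℝ, ℂ)) : Prop :=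
  LocallyIntegrable g volume ∧
    ∀ ψ : 𝓢(ℝ, ℂ), HasCompactSupport ψ → T ψ = ∫ u, g u * ψ u

/-- `F(τ) = \hat f(1/2 + iτ)`, the (left) Mellin–Plancherel transform of `f` on the critical line:
the limit in `L²(dτ)` of `∫_a^A f(x) x^{s-1} dx`, `s = 1/2 + iτ`, as `a → 0+` and `A → ∞`. -/
def IsMellinPlancherel (f F : ℝ → ℂ) : Prop :=
  MemLp F 2 volume ∧
    Tendsto
      (fun p : ℝ × ℝ ↦ eLpNorm
        (fun τ : ℝ ↦ (∫ x in p.1..p.2,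
          f x * (x : ℂ) ^ ((1 / 2 + (τ : ℂ) * Complex.I) - 1)) - F τ) 2 volume)
      (𝓝[>] (0 : ℝ) ×ˢ atTop) (𝓝 0)

/-- Multiplication by `(2π)⁻¹` on `ℝ`. -/
def dilation : ℝ ≃L[ℝ] ℝ :=
  ContinuousLinearEquiv.unitsEquivAut ℝ
    (Units.mk0 (2 * Real.pi)⁻¹ (inv_ne_zero (mul_ne_zero two_ne_zero Real.pi_ne_zero)))

/-- The map `θ ↦ (u ↦ ∫ θ(τ) e^{iτu} dτ)` on Schwartz functions; see `expTransform_apply`. -/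
def expTransform : 𝓢(ℝ, ℂ) →L[ℂ] 𝓢(ℝ, ℂ) :=
  (SchwartzMap.compCLMOfContinuousLinearEquiv ℂ dilation).comp
    (FourierTransform.fourierInvCLM ℂ 𝓢(ℝ, ℂ))

theorem expTransform_apply (θ : 𝓢(ℝ, ℂ)) (u : ℝ) :
    expTransform θ u = ∫ τ : ℝ, θ τ * Complex.exp (Complex.I * τ * u) := by
  have h : expTransform θ u = 𝓕⁻ (θ : ℝ → ℂ) (u * (2 * Real.pi)⁻¹) := by
    rw [← SchwartzMap.fourierInv_coe]; rfl
  rw [h, Real.fourierInv_eq']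
  refine integral_congr_ae (Eventually.of_forall fun τ ↦ ?_)
  have hpi : (Real.pi : ℂ) ≠ 0 := by exact_mod_cast Real.pi_ne_zero
  simp only [smul_eq_mul, RCLike.inner_apply, conj_trivial]
  rw [mul_comm]
  congr 2
  push_cast
  field_simp

/-- The Fourier transform `τ ↦ ∫ T(u) e^{iτu} du` of a tempered distribution `T`, defined by
duality. With `u = log x` this is the Mellin transform `τ ↦ ∫_0^∞ T(log x) x^{iτ} dx/x`. -/
def mellinFourier (T : 𝓢'(ℝ, ℂ)) : 𝓢'(ℝ, ℂ) :=
  PointwiseConvergenceCLM.precomp ℂ expTransform T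

theorem mellinFourier_apply (T : 𝓢'(ℝ, ℂ)) (θ : 𝓢(ℝ, ℂ)) :
    mellinFourier T θ = T (expTransform θ) := rfl

theorem hasCompactSupport_logPullback (φ : 𝓓(halfLine, ℂ)) :
    HasCompactSupport (fun u : ℝ ↦ (Real.exp (u / 2) : ℂ) * φ (Real.exp u)) := by
  have hK : IsCompact (Real.log '' tsupport φ) := by
    refine φ.hasCompactSupport.isCompact.image_of_continuousOn ?_
    refine Real.continuousOn_log.mono fun x hx ↦ ?_
    have : (0 : ℝ) < x := φ.tsupport_subset hx
    exact this.ne'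
  refine HasCompactSupport.intro hK fun u hu ↦ ?_
  have : φ (Real.exp u) = 0 := by
    by_contra h
    exact hu ⟨Real.exp u, subset_tsupport _ h, Real.log_exp u⟩
  simp [this]

theorem contDiff_logPullback (φ : 𝓓(halfLine, ℂ)) :
    ContDiff ℝ ∞ (fun u : ℝ ↦ (Real.exp (u / 2) : ℂ) * φ (Real.exp u)) := by
  have h1 : ContDiff ℝ ∞ (fun u : ℝ ↦ (Real.exp (u / 2) : ℂ)) :=
    Complex.ofRealCLM.contDiff.comp (Real.contDiff_exp.comp (contDiff_id.div_const 2))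
  have h2 : ContDiff ℝ ∞ φ := φ.contDiff
  exact h1.mul (h2.comp Real.contDiff_exp)

/-- For a test function `φ` on `]0, ∞[`, the function `ψ(u) = e^{u/2} φ(e^u)`, so that
`φ(x) = x^{-1/2} ψ(log x)`. A distribution `D` on `]0, ∞[` is such that `√x D(x)` is the
distribution `T` in the variable `u = log x` exactly when
`∫_0^∞ D(x) φ(x) dx = ∫ (e^{u/2} D(e^u)) (e^{u/2} φ(e^u)) du = T(ψ)` for all `φ`. -/
def logPullback (φ : 𝓓(halfLine, ℂ)) : 𝓢(ℝ, ℂ) :=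
  (hasCompactSupport_logPullback φ).toSchwartzMap (contDiff_logPullback φ)

theorem logPullback_apply (φ : 𝓓(halfLine, ℂ)) (u : ℝ) :
    logPullback φ u = (Real.exp (u / 2) : ℂ) * φ (Real.exp u) := rfl

/-- The modified co-sum `∑_{n ≥ 1} φ(x/n)/n - ∫_0^∞ φ(1/t)/t dt`, for `x > 0` (the sum has finitely
many non-zero terms when `φ` has compact support in `]0, ∞[`). -/
def coSum (φ : ℝ → ℂ) (x : ℝ) : ℂ :=
  ∑' n : ℕ, φ (x / (n + 1)) / ((n : ℂ) + 1) - ∫ t in Ioi (0 : ℝ), φ (1 / t) / (t : ℂ)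

/-- `G(x) = ∫_0^∞ f(x u) {u}/u du`. -/
def fractIntegral (f : ℝ → ℂ) (x : ℝ) : ℂ :=
  ∫ u in Ioi (0 : ℝ), f (x * u) * ((Int.fract u / u : ℝ) : ℂ)

/-- `D = x (d/dx) G` in the sense of distributions on `]0, ∞[`, for a locally integrable `G`:
`∫ D φ = - ∫_0^∞ G(x) (x φ(x))' dx` for all test functions `φ`. -/
def IsEulerDeriv (G : ℝ → ℂ) (D : HalfLineDistribution) : Prop :=
  LocallyIntegrableOn G (Ioi 0) volume ∧
    ∀ φ : 𝓓(halfLine, ℂ),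
      D φ = -∫ x in Ioi (0 : ℝ), G x * deriv (fun y : ℝ ↦ (y : ℂ) * φ y) x

end Muntz

end

/-! In the variable `u = log x` everything becomes convolution on `ℝ`. Let `h(u) = e^{u/2} f(e^u)`,
which lies in `L²`, and `k(w) = e^{-w/2}{e^w}`, which is at most `e^{-|w|/2}` and so lies in `L¹ ∩
L²`. Then `g(u) = ∫ h(v) k(v - u) dv` is `√x G(x)`, bounded and continuous, and `√x · x G'(x)` reads
`g' - g/2`. This is the tempered distribution `T` (`sumDistribution`). By Fubini, `T(ψ) = -∫ h ·
K(ψ' + ψ/2)`, with `K` the transposed convolution (`dualConv`), and every claim is read off this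
pairing.

Since `{y} = y - ∑ 1_{n ≤ y}`, the form `K(ψ' + ψ/2)` integrates explicitly to minus a modified
co-sum (`dualConv_deriv_add`). Cutting `h` off at `log Λ` makes all sums finite, and translating
each term turns the pairing into that of `√x A_Λ` (`integral_truncSum_mul`). Removing the cutoff is
dominated convergence.

For the spectral side, `∫_0^∞ {t} t^{-s-1} dt = -ζ(s)/s` for `0 < Re s < 1`, obtained by continuing
Abel summation. On `e^{iτu}` the operator `∂ + 1/2` multiplies by `s = 1/2 + iτ` and `K` by
`-ζ(s)/s`, so together they multiply by `-ζ(s)` (`dualConv_expTransform`). Plancherel duality then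
gives `ζ(s) \hat f(s)`. -/

noncomputable section

namespace Muntz

/-! ### The kernel `{y}/√y` in logarithmic coordinates, its convolution and transpose. -/

/-- The function `x ↦ √x f(x)` in the variable `u = log x`. -/
def logSide (f : ℝ → ℂ) (u : ℝ) : ℂ := (Real.exp (u / 2) : ℂ) * f (Real.exp u)

/-- The kernel `y ↦ {y}/√y` in the variable `w = log y`. -/
def fractKernel (w : ℝ) : ℂ := ((Real.exp (-w / 2) * Int.fract (Real.exp w) : ℝ) : ℂ)

/-- `u ↦ ∫ h(v) k(v - u) dv` for the kernel `k = fractKernel`. -/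
def fractConv (h : ℝ → ℂ) (u : ℝ) : ℂ := ∫ v, h v * fractKernel (v - u)

/-- `v ↦ ∫ k(v - u) χ(u) du` for the kernel `k = fractKernel`. -/
def dualConv (χ : ℝ → ℂ) (v : ℝ) : ℂ := ∫ u, fractKernel (v - u) * χ u

/-- Use `{y} ≤ 1` for `y ≥ 1` and `{y} ≤ y` for `y ≤ 1`. The decay at both ends gives `L²`, needed
to pair with `h`, and `L¹`, needed for the Fourier transform of the kernel. -/
theorem norm_fractKernel_le (w : ℝ) : ‖fractKernel w‖ ≤ Real.exp (-|w| / 2) := by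
  have h0 := Int.fract_nonneg (Real.exp w)
  rw [fractKernel, Complex.norm_real, Real.norm_of_nonneg (by positivity)]
  rcases le_total 0 w with hw | hw
  · rw [abs_of_nonneg hw]
    exact mul_le_of_le_one_right (by positivity) (Int.fract_lt_one _).le
  · rw [abs_of_nonpos hw]
    calc Real.exp (-w / 2) * Int.fract (Real.exp w)
        ≤ Real.exp (-w / 2) * Real.exp w := by
          gcongr
          rw [Int.fract]
          have : (0 : ℝ) ≤ ⌊Real.exp w⌋ := by exact_mod_cast Int.floor_nonneg.2 (Real.exp_pos w).le
          linarith
      _ = Real.exp (- -w / 2) := by rw [← Real.exp_add]; congr 1; ring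

theorem measurable_fractKernel : Measurable fractKernel := by
  unfold fractKernel
  fun_prop

theorem integrable_exp_neg_abs {c : ℝ} (hc : 0 < c) :
    Integrable (fun w : ℝ ↦ Real.exp (-c * |w|)) := by
  rw [← integrableOn_univ, ← Iic_union_Ioi (a := (0 : ℝ)), integrableOn_union]
  refine ⟨(integrableOn_exp_mul_Iic hc 0).congr_fun (fun w hw ↦ ?_) measurableSet_Iic,
    (integrableOn_exp_mul_Ioi (neg_lt_zero.2 hc) 0).congr_fun (fun w hw ↦ ?_) measurableSet_Ioi⟩
  · simp [abs_of_nonpos (mem_Iic.1 hw)]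
  · simp [abs_of_pos (mem_Ioi.1 hw)]

theorem integrable_fractKernel : Integrable fractKernel := by
  refine (integrable_exp_neg_abs (half_pos one_pos)).mono'
    measurable_fractKernel.aestronglyMeasurable (Eventually.of_forall fun w ↦ ?_)
  refine (norm_fractKernel_le w).trans_eq ?_
  congr 1
  ring

theorem memLp_exp_neg_abs : MemLp (fun w : ℝ ↦ Real.exp (-|w| / 2)) 2 := by
  rw [memLp_two_iff_integrable_sq (by fun_prop)]
  refine (integrable_exp_neg_abs one_pos).congr (Eventually.of_forall fun w ↦ ?_)
  simp only [← Real.exp_nat_mul]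
  congr 1
  push_cast
  ring

theorem memLp_fractKernel : MemLp fractKernel 2 :=
  memLp_exp_neg_abs.mono measurable_fractKernel.aestronglyMeasurable
    (Eventually.of_forall fun w ↦ (norm_fractKernel_le w).trans (Real.le_norm_self _))

theorem memLp_fractKernel_sub (u : ℝ) : MemLp (fun v ↦ fractKernel (v - u)) 2 :=
  memLp_fractKernel.comp_measurePreserving (measurePreserving_sub_right volume u)

theorem integrable_mul_fractKernel {h : ℝ → ℂ} (hh : MemLp h 2) (u : ℝ) :
    Integrable (fun v ↦ h v * fractKernel (v - u)) :=
  hh.integrable_mul (memLp_fractKernel_sub u)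

/-- A crude `ab ≤ a² + b²` replaces Cauchy–Schwarz; what matters is that the bound does not depend
on `u`. -/
theorem integral_norm_mul_fractKernel_le {h : ℝ → ℂ} (hh : MemLp h 2) (u : ℝ) :
    ∫ v, ‖h v * fractKernel (v - u)‖ ≤ (∫ v, ‖h v‖ ^ 2) + ∫ v, ‖fractKernel v‖ ^ 2 := by
  have h1 : Integrable (fun v ↦ ‖h v‖ ^ 2) := hh.integrable_norm_pow two_ne_zero
  have h2 : Integrable (fun v ↦ ‖fractKernel (v - u)‖ ^ 2) :=
    (memLp_fractKernel_sub u).integrable_norm_pow two_ne_zero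
  rw [← integral_sub_right_eq_self (fun v ↦ ‖fractKernel v‖ ^ 2) u, ← integral_add h1 h2]
  refine integral_mono (integrable_mul_fractKernel hh u).norm (h1.add h2) fun v ↦ ?_
  simp only [norm_mul]
  nlinarith [sq_nonneg (‖h v‖ - ‖fractKernel (v - u)‖), sq_nonneg ‖h v‖,
    sq_nonneg ‖fractKernel (v - u)‖]

theorem norm_fractConv_le {h : ℝ → ℂ} (hh : MemLp h 2) (u : ℝ) :
    ‖fractConv h u‖ ≤ (∫ v, ‖h v‖ ^ 2) + ∫ v, ‖fractKernel v‖ ^ 2 :=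
  (norm_integral_le_integral_norm _).trans (integral_norm_mul_fractKernel_le hh u)

theorem continuousAt_fractKernel {w : ℝ} (hw : ∀ n : ℕ, Real.exp w ≠ n) :
    ContinuousAt fractKernel w := by
  have hne : ∀ n : ℤ, Real.exp w ≠ n := fun n hn ↦ by
    have : 0 ≤ n := by exact_mod_cast (hn ▸ (Real.exp_pos w).le : (0 : ℝ) ≤ n)
    lift n to ℕ using this
    exact hw n (by simpa using hn)
  have h1 : ContinuousAt (Int.fract : ℝ → ℝ) (Real.exp w) := by
    have hlt : (⌊Real.exp w⌋ : ℝ) < Real.exp w := (Int.floor_le _).lt_of_ne (hne _).symm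
    exact (continuousOn_fract ⌊Real.exp w⌋).continuousAt
      (mem_of_superset (Ioo_mem_nhds hlt (Int.lt_floor_add_one _)) Ioo_subset_Ico_self)
  unfold fractKernel
  refine Complex.continuous_ofReal.continuousAt.comp (ContinuousAt.mul (by fun_prop) ?_)
  exact ContinuousAt.comp (f := Real.exp) h1 Real.continuous_exp.continuousAt

/-- Dominated convergence: the jumps of the kernel, at the points `log n`, are countable and hence
negligible in `v`. -/
theorem continuous_fractConv {h : ℝ → ℂ} (hh : MemLp h 2) : Continuous (fractConv h) := by
  rw [continuous_iff_continuousAt]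
  intro u₀
  -- The factor `e^{1/2}` absorbs the displacement `|u - u₀| < 1` in the exponent.
  have hb : MemLp (fun v : ℝ ↦ Real.exp (1 / 2) * Real.exp (-|v - u₀| / 2)) 2 :=
    (memLp_exp_neg_abs.comp_measurePreserving (measurePreserving_sub_right volume u₀)).const_mul _
  refine continuousAt_of_dominated
    (bound := fun v ↦ ‖h v‖ * (Real.exp (1 / 2) * Real.exp (-|v - u₀| / 2)))
    (Eventually.of_forall fun u ↦ (integrable_mul_fractKernel hh u).aestronglyMeasurable)
    ?_ (hh.norm.integrable_mul hb) ?_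
  · filter_upwards [Metric.ball_mem_nhds u₀ one_pos] with u hu
    refine Eventually.of_forall fun v ↦ ?_
    rw [norm_mul]
    gcongr
    refine (norm_fractKernel_le _).trans ?_
    rw [← Real.exp_add]
    gcongr
    rw [Metric.mem_ball, Real.dist_eq] at hu
    have := abs_sub_le v u u₀
    linarith
  · have hc : (Set.range fun n : ℕ ↦ u₀ + Real.log n).Countable := countable_range _
    filter_upwards [hc.ae_notMem volume] with v hv
    refine ContinuousAt.mul continuousAt_const ?_
    refine ContinuousAt.comp (f := fun u ↦ v - u) (g := fractKernel) ?_ (by fun_prop)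
    refine continuousAt_fractKernel fun n hn ↦ hv ⟨n, ?_⟩
    simp only [← hn, Real.log_exp]
    ring

theorem integrable_prod_fractKernel {h χ : ℝ → ℂ} (hh : MemLp h 2) (hχ : Integrable χ) :
    Integrable (fun p : ℝ × ℝ ↦ h p.2 * fractKernel (p.2 - p.1) * χ p.1)
      (volume.prod volume) := by
  have hm : AEStronglyMeasurable (fun p : ℝ × ℝ ↦ h p.2 * fractKernel (p.2 - p.1) * χ p.1)
      (volume.prod volume) := by
    refine (hh.aestronglyMeasurable.comp_snd.mul ?_).mul hχ.aestronglyMeasurable.comp_fst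
    exact (measurable_fractKernel.comp (by fun_prop)).aestronglyMeasurable
  rw [integrable_prod_iff hm]
  refine ⟨Eventually.of_forall fun u ↦ (integrable_mul_fractKernel hh u).mul_const (χ u), ?_⟩
  refine (hχ.norm.const_mul ((∫ v, ‖h v‖ ^ 2) + ∫ v, ‖fractKernel v‖ ^ 2)).mono'
    hm.norm.integral_prod_right' (Eventually.of_forall fun u ↦ ?_)
  have : ∀ v, ‖h v * fractKernel (v - u) * χ u‖ = ‖h v * fractKernel (v - u)‖ * ‖χ u‖ :=
    fun v ↦ norm_mul _ _
  simp only [this, integral_mul_const]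
  rw [Real.norm_of_nonneg (by positivity)]
  gcongr
  exact integral_norm_mul_fractKernel_le hh u

theorem integrable_mul_dualConv {h χ : ℝ → ℂ} (hh : MemLp h 2) (hχ : Integrable χ) :
    Integrable (fun v ↦ h v * dualConv χ v) := by
  refine (integrable_prod_fractKernel hh hχ).integral_prod_right.congr
    (Eventually.of_forall fun v ↦ ?_)
  simp only [mul_assoc, integral_const_mul, dualConv]

/-- Fubini. It moves the kernel onto the test function, so that truncation and limits act on `h`
alone. -/
theorem integral_fractConv_mul {h χ : ℝ → ℂ} (hh : MemLp h 2) (hχ : Integrable χ) :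
    ∫ u, fractConv h u * χ u = ∫ v, h v * dualConv χ v := by
  have := integral_integral_swap (f := fun u v ↦ h v * fractKernel (v - u) * χ u)
    (integrable_prod_fractKernel hh hχ)
  simp only [integral_mul_const] at this
  simpa only [mul_assoc, integral_const_mul, dualConv, fractConv] using this

/-! ### The change of variable `x = e^u`. -/

theorem image_exp_univ : Real.exp '' univ = Ioi 0 := by rw [image_univ, Real.range_exp]

theorem integral_Ioi_zero_eq_integral_exp (F : ℝ → ℂ) :
    ∫ x in Ioi (0 : ℝ), F x = ∫ u, (Real.exp u : ℂ) * F (Real.exp u) := by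
  rw [← image_exp_univ, integral_image_eq_integral_abs_deriv_smul MeasurableSet.univ
    (fun x _ ↦ (Real.hasDerivAt_exp x).hasDerivWithinAt) Real.exp_injective.injOn]
  simp

theorem integrableOn_Ioi_zero_iff_exp (F : ℝ → ℂ) :
    IntegrableOn F (Ioi 0) ↔ Integrable fun u ↦ (Real.exp u : ℂ) * F (Real.exp u) := by
  rw [← image_exp_univ, integrableOn_image_iff_integrableOn_abs_deriv_smul MeasurableSet.univ
    (fun x _ ↦ (Real.hasDerivAt_exp x).hasDerivWithinAt) Real.exp_injective.injOn]
  simp [integrableOn_univ]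

/-- Null sets pull back to null sets because `log`, differentiable on `]0, ∞[`, maps null sets to
null sets. This makes `f(e^u)` a.e. strongly measurable. -/
theorem quasiMeasurePreserving_exp :
    Measure.QuasiMeasurePreserving Real.exp volume (volume.restrict (Ioi 0)) := by
  refine ⟨Real.measurable_exp, Measure.AbsolutelyContinuous.mk fun s hs h0 ↦ ?_⟩
  rw [Measure.map_apply Real.measurable_exp hs]
  rw [Measure.restrict_apply hs] at h0
  have : Real.exp ⁻¹' s ⊆ Real.log '' (s ∩ Ioi 0) :=
    fun u hu ↦ ⟨Real.exp u, ⟨hu, Real.exp_pos u⟩, Real.log_exp u⟩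
  refine measure_mono_null this (addHaar_image_eq_zero_of_differentiableOn_of_addHaar_eq_zero _
    (fun x hx ↦ ?_) h0)
  exact (Real.differentiableAt_log hx.2.ne').differentiableWithinAt

theorem memLp_logSide {f : ℝ → ℂ} (hf : MemLp f 2 (volume.restrict (Ioi (0 : ℝ)))) :
    MemLp (logSide f) 2 := by
  have hm : AEStronglyMeasurable (logSide f) :=
    (Continuous.aestronglyMeasurable (by fun_prop)).mul
      (hf.aestronglyMeasurable.comp_quasiMeasurePreserving quasiMeasurePreserving_exp)
  rw [memLp_two_iff_integrable_sq_norm hm]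
  have h1 : IntegrableOn (fun x ↦ ‖f x‖ ^ 2) (Ioi 0) := hf.integrable_norm_pow two_ne_zero
  rw [← image_exp_univ, integrableOn_image_iff_integrableOn_abs_deriv_smul MeasurableSet.univ
    (fun x _ ↦ (Real.hasDerivAt_exp x).hasDerivWithinAt) Real.exp_injective.injOn,
    integrableOn_univ] at h1
  refine h1.congr (Eventually.of_forall fun u ↦ ?_)
  simp only [logSide, norm_mul, Complex.norm_real, mul_pow, smul_eq_mul, Real.norm_eq_abs,
    Real.abs_exp, ← Real.exp_nat_mul]
  congr 2
  push_cast
  ring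

theorem fractIntegral_integrand (f : ℝ → ℂ) (x u : ℝ) :
    (Real.exp (x / 2) : ℂ) * ((Real.exp u : ℂ) * (f (Real.exp x * Real.exp u) *
      ((Int.fract (Real.exp u) / Real.exp u : ℝ) : ℂ))) =
    logSide f (u + x) * fractKernel (u + x - x) := by
  have h : Real.exp (x / 2) * (Real.exp u * (Int.fract (Real.exp u) / Real.exp u)) =
      Real.exp ((u + x) / 2) * (Real.exp (-u / 2) * Int.fract (Real.exp u)) := by
    rw [mul_div_cancel₀ _ (Real.exp_pos u).ne', ← mul_assoc, ← Real.exp_add]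
    congr 2
    ring
  have h' := congrArg (Complex.ofReal) h
  simp only [logSide, fractKernel, add_sub_cancel_right, ← Real.exp_add, add_comm x u]
  push_cast at h' ⊢
  linear_combination f (Real.exp (u + x)) * h'

theorem integrableOn_fractIntegral {f : ℝ → ℂ} (hf : MemLp f 2 (volume.restrict (Ioi (0 : ℝ))))
    {x : ℝ} (hx : 0 < x) :
    IntegrableOn (fun u : ℝ ↦ f (x * u) * ((Int.fract u / u : ℝ) : ℂ)) (Ioi 0) := by
  obtain ⟨y, rfl⟩ : ∃ y, Real.exp y = x := ⟨_, Real.exp_log hx⟩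
  rw [integrableOn_Ioi_zero_iff_exp]
  have h1 := (integrable_mul_fractKernel (memLp_logSide hf) y).comp_add_right y
  simp only [← fractIntegral_integrand] at h1
  refine (h1.const_mul ((Real.exp (y / 2) : ℂ)⁻¹)).congr (Eventually.of_forall fun u ↦ ?_)
  have : (Real.exp (y / 2) : ℂ) ≠ 0 := by exact_mod_cast (Real.exp_pos _).ne'
  simp only [inv_mul_cancel_left₀ this]

theorem exp_mul_fractIntegral (f : ℝ → ℂ) (y : ℝ) :
    (Real.exp (y / 2) : ℂ) * fractIntegral f (Real.exp y) = fractConv (logSide f) y := by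
  rw [fractIntegral, integral_Ioi_zero_eq_integral_exp, ← integral_const_mul, fractConv,
    ← integral_add_right_eq_self (fun v ↦ logSide f v * fractKernel (v - y)) y]
  simp only [fractIntegral_integrand]

theorem continuousOn_fractIntegral {f : ℝ → ℂ} (hf : MemLp f 2 (volume.restrict (Ioi (0 : ℝ)))) :
    ContinuousOn (fractIntegral f) (Ioi 0) := by
  have : ContinuousOn (fun x ↦ ((Real.exp (Real.log x / 2) : ℝ) : ℂ)⁻¹ *
      fractConv (logSide f) (Real.log x)) (Ioi 0) := by
    have hl : ContinuousOn Real.log (Ioi 0) :=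
      Real.continuousOn_log.mono fun x hx ↦ (mem_Ioi.1 hx).ne'
    refine ContinuousOn.mul (ContinuousOn.inv₀ ?_ fun x _ ↦ ?_)
      ((continuous_fractConv (memLp_logSide hf)).comp_continuousOn hl)
    · exact (Complex.continuous_ofReal.comp Real.continuous_exp).comp_continuousOn
        (hl.div_const 2)
    · exact_mod_cast (Real.exp_pos _).ne'
  refine this.congr fun x hx ↦ ?_
  have h0 : ((Real.exp (Real.log x / 2) : ℝ) : ℂ) ≠ 0 := by exact_mod_cast (Real.exp_pos _).ne'
  simp only [← exp_mul_fractIntegral]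
  rw [inv_mul_cancel_left₀ h0, Real.exp_log hx]

/-! ### The Mellin transform of the fractional part and `ζ`. -/

open Asymptotics in
-- Cutting to `t > 1` removes any constraint at `0`; boundedness at infinity gives the half-plane
-- `Re s > 0`.
theorem differentiableAt_mellin_fract {s : ℂ} (hs : 0 < s.re) :
    DifferentiableAt ℂ
      (fun s ↦ mellin ((Ioi (1 : ℝ)).indicator fun t ↦ ((Int.fract t : ℝ) : ℂ)) (-s)) s := by
  have hb : ∀ t, ‖(Ioi (1 : ℝ)).indicator (fun t ↦ ((Int.fract t : ℝ) : ℂ)) t‖ ≤ 1 := fun t ↦ by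
    refine (norm_indicator_le_norm_self _ _).trans ?_
    rw [Complex.norm_real, Real.norm_of_nonneg (Int.fract_nonneg t)]
    exact (Int.fract_lt_one t).le
  have hm : Measurable ((Ioi (1 : ℝ)).indicator fun t ↦ ((Int.fract t : ℝ) : ℂ)) :=
    (Complex.measurable_ofReal.comp measurable_fract).indicator measurableSet_Ioi
  -- The Mellin transform is taken at `-s`, so `b` only has to lie below `-Re s`; the function
  -- vanishes near `0`, so any such `b` works.
  refine DifferentiableAt.comp s (f := fun s ↦ -s) (mellin_differentiableAt_of_isBigO_rpow (a := 0)
    (b := -s.re - 1) ?_ ?_ (by simpa using hs) ?_ (by simp)) differentiableAt_id.neg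
  · refine LocallyIntegrable.locallyIntegrableOn ?_ _
    refine (locallyIntegrable_const (1 : ℝ)).mono hm.aestronglyMeasurable
      (Eventually.of_forall fun t ↦ by simpa using hb t)
  · refine IsBigO.of_bound 1 (Eventually.of_forall fun t ↦ ?_)
    simpa using hb t
  · refine IsBigO.of_bound 1 ?_
    filter_upwards [Ioo_mem_nhdsGT (zero_lt_one' ℝ)] with t ht
    rw [indicator_of_notMem (by simpa using ht.2.le)]
    simp only [norm_zero]
    positivity

theorem integrableOn_fract_mul_cpow {s : ℂ} (hs : 0 < s.re) :
    IntegrableOn (fun t : ℝ ↦ ((Int.fract t : ℝ) : ℂ) * (t : ℂ) ^ (-(s + 1))) (Ioi 1) := by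
  have h1 : IntegrableOn (fun t : ℝ ↦ (t : ℂ) ^ (-(s + 1))) (Ioi 1) :=
    integrableOn_Ioi_cpow_of_lt (by simpa using hs) one_pos
  refine h1.bdd_mul (c := 1) (Complex.measurable_ofReal.comp measurable_fract).aestronglyMeasurable
    (Eventually.of_forall fun t ↦ ?_)
  simp only [Complex.norm_real]
  rw [Real.norm_of_nonneg (Int.fract_nonneg t)]
  exact (Int.fract_lt_one t).le

theorem mellin_fract_eq (s : ℂ) :
    mellin ((Ioi (1 : ℝ)).indicator fun t ↦ ((Int.fract t : ℝ) : ℂ)) (-s) =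
      ∫ t in Ioi (1 : ℝ), ((Int.fract t : ℝ) : ℂ) * (t : ℂ) ^ (-(s + 1)) := by
  rw [mellin, ← integral_indicator measurableSet_Ioi, ← integral_indicator measurableSet_Ioi]
  congr 1
  ext t
  by_cases h : 1 < t
  · have h0 : 0 < t := by linarith
    simp only [indicator_of_mem (mem_Ioi.2 h), indicator_of_mem (mem_Ioi.2 h0), smul_eq_mul]
    rw [mul_comm, neg_add, sub_eq_add_neg]
  · by_cases h0 : 0 < t <;> simp [h, h0]

/-- Abel summation gives `ζ(s) = s ∫_1^∞ ⌊t⌋ t^{-s-1} dt`. Writing `⌊t⌋ = t - {t}` isolates `s/(s-1)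
= 1 + 1/(s-1)`, whose polar part is exactly what `riemannZeta₀` omits. -/
theorem riemannZeta₀_eq_of_one_lt_re {s : ℂ} (hs : 1 < s.re) :
    riemannZeta₀ s = 1 - s *
      ∫ t in Ioi (1 : ℝ), ((Int.fract t : ℝ) : ℂ) * (t : ℂ) ^ (-(s + 1)) := by
  have hs1 : s ≠ 1 := by rintro rfl; simp at hs
  have hs1' : s - 1 ≠ 0 := sub_ne_zero.2 hs1
  have hs0 : s ≠ 0 := by rintro rfl; norm_num at hs
  have hsum : ∀ n : ℕ, ∑ k ∈ Finset.Icc 1 n, (1 : ℕ → ℂ) k = n := by simp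
  have hz : riemannZeta s = s * ∫ t in Ioi (1 : ℝ), (⌊t⌋₊ : ℂ) * (t : ℂ) ^ (-(s + 1)) := by
    rw [← LSeries_one_eq_riemannZeta hs, LSeries_eq_mul_integral 1 zero_le_one hs
      (LSeriesSummable_one_iff.2 hs)]
    · simp only [hsum]
    · simp only [hsum]
      refine Asymptotics.IsBigO.of_bound 1 (Eventually.of_forall fun n ↦ ?_)
      simp
  have hi : IntegrableOn (fun t : ℝ ↦ (t : ℂ) ^ (-s)) (Ioi 1) :=
    integrableOn_Ioi_cpow_of_lt (by simpa using hs) one_pos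
  have hsplit : ∫ t in Ioi (1 : ℝ), (⌊t⌋₊ : ℂ) * (t : ℂ) ^ (-(s + 1)) =
      (∫ t in Ioi (1 : ℝ), (t : ℂ) ^ (-s)) -
        ∫ t in Ioi (1 : ℝ), ((Int.fract t : ℝ) : ℂ) * (t : ℂ) ^ (-(s + 1)) := by
    rw [← integral_sub hi (integrableOn_fract_mul_cpow (by linarith))]
    refine setIntegral_congr_fun measurableSet_Ioi fun t ht ↦ ?_
    have ht0 : (0 : ℝ) < t := zero_lt_one.trans ht
    have h1 : (t : ℂ) ^ (-s) = t * (t : ℂ) ^ (-(s + 1)) := by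
      rw [neg_add, Complex.cpow_add _ _ (by exact_mod_cast ht0.ne'), Complex.cpow_neg_one]
      field_simp [(by exact_mod_cast ht0.ne' : (t : ℂ) ≠ 0)]
    have h2 : (⌊t⌋₊ : ℂ) = t - ((Int.fract t : ℝ) : ℂ) := by
      rw [← Complex.ofReal_sub, Int.self_sub_fract, ← natCast_floor_eq_intCast_floor ht0.le]
      simp
    simp only [h1, h2]
    ring
  have hone : ∫ t in Ioi (1 : ℝ), (t : ℂ) ^ (-s) = (s - 1)⁻¹ := by
    rw [integral_Ioi_cpow_of_lt (by simpa using hs) one_pos]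
    rw [Complex.ofReal_one, Complex.one_cpow, show -s + 1 = -(s - 1) by ring, neg_div_neg_eq,
      one_div]
  rw [eq_sub_of_add_eq' (riemannZeta_eq_inv_sub_add hs1).symm, hz, hsplit, hone]
  field_simp
  ring

/-- Identity principle on `Re s > 0`. Working with `riemannZeta₀` avoids puncturing the half-plane
at `1`. -/
theorem riemannZeta₀_eq {s : ℂ} (hs : 0 < s.re) :
    riemannZeta₀ s = 1 - s *
      ∫ t in Ioi (1 : ℝ), ((Int.fract t : ℝ) : ℂ) * (t : ℂ) ^ (-(s + 1)) := by
  have ho : IsOpen {s : ℂ | 0 < s.re} := isOpen_lt continuous_const Complex.continuous_re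
  have hc : IsPreconnected {s : ℂ | 0 < s.re} := (convex_halfSpace_re_gt 0).isPreconnected
  have h1 : AnalyticOnNhd ℂ riemannZeta₀ {s : ℂ | 0 < s.re} :=
    differentiable_riemannZeta₀.differentiableOn.analyticOnNhd ho
  have h2 : AnalyticOnNhd ℂ (fun s ↦ 1 - s *
      mellin ((Ioi (1 : ℝ)).indicator fun t ↦ ((Int.fract t : ℝ) : ℂ)) (-s))
      {s : ℂ | 0 < s.re} := by
    refine DifferentiableOn.analyticOnNhd (fun s hs ↦ ?_) ho
    exact ((differentiableAt_const _).sub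
      (differentiableAt_id.mul (differentiableAt_mellin_fract hs))).differentiableWithinAt
  have := h1.eqOn_of_preconnected_of_eventuallyEq h2 hc (z₀ := 2) (by simp) ?_ hs
  · simpa only [mellin_fract_eq] using this
  · filter_upwards [(isOpen_lt continuous_const Complex.continuous_re).mem_nhds
      (show (1 : ℝ) < (2 : ℂ).re by simp)] with z hz
    rw [mellin_fract_eq, riemannZeta₀_eq_of_one_lt_re hz]

/-- On `]0, 1[` one has `{t} = t`, which contributes `1/(1-s)` and cancels the term `(1 +
1/(s-1))/s` coming from `t > 1`. -/
theorem integral_Ioi_zero_fract_mul_cpow {s : ℂ} (h0 : 0 < s.re) (h1 : s.re < 1) :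
    ∫ t in Ioi (0 : ℝ), ((Int.fract t : ℝ) : ℂ) * (t : ℂ) ^ (-(s + 1)) = -riemannZeta s / s := by
  have hs1 : s ≠ 1 := by rintro rfl; simp at h1
  have hs1' : s - 1 ≠ 0 := sub_ne_zero.2 hs1
  have hs0 : s ≠ 0 := by rintro rfl; norm_num at h0
  have e : EqOn (fun t : ℝ ↦ ((Int.fract t : ℝ) : ℂ) * (t : ℂ) ^ (-(s + 1)))
      (fun t : ℝ ↦ (t : ℂ) ^ (-s)) (Ioo 0 1) := fun t ht ↦ by
    have ht0 : (t : ℂ) ≠ 0 := by exact_mod_cast ht.1.ne'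
    simp only [Int.fract_eq_self.2 ⟨ht.1.le, ht.2⟩]
    rw [neg_add, Complex.cpow_add _ _ ht0, Complex.cpow_neg_one]
    field_simp
  have hi : IntervalIntegrable (fun t : ℝ ↦ (t : ℂ) ^ (-s)) volume 0 1 :=
    intervalIntegral.intervalIntegrable_cpow' (by simpa using h1)
  rw [intervalIntegrable_iff_integrableOn_Ioo_of_le zero_le_one] at hi
  have hv : ∫ t in Ioo (0 : ℝ) 1, (t : ℂ) ^ (-s) = (1 - s)⁻¹ := by
    rw [← integral_Ioc_eq_integral_Ioo, ← intervalIntegral.integral_of_le zero_le_one,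
      integral_cpow (Or.inl (by simpa using h1))]
    have : -s + 1 ≠ 0 := by rw [neg_add_eq_sub]; exact sub_ne_zero.2 hs1.symm
    rw [Complex.ofReal_one, Complex.one_cpow, Complex.ofReal_zero, Complex.zero_cpow this,
      sub_zero, one_div, neg_add_eq_sub]
  rw [← Ioc_union_Ioi_eq_Ioi zero_le_one, setIntegral_union (by simp [Set.disjoint_left])
    measurableSet_Ioi
    ((integrableOn_Ioc_iff_integrableOn_Ioo).2 (hi.congr_fun e.symm measurableSet_Ioo))
    (integrableOn_fract_mul_cpow h0), integral_Ioc_eq_integral_Ioo,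
    setIntegral_congr_fun measurableSet_Ioo e, hv, riemannZeta_eq_inv_sub_add hs1,
    riemannZeta₀_eq h0]
  have hs2 : 1 - s ≠ 0 := sub_ne_zero.2 hs1.symm
  field_simp
  ring

/-! ### The transposed kernel and finite co-sums. -/

/-- The floor counts the integers in `[1, y]`. Any sufficiently large `N` is allowed, so that one
`N` can serve a whole range of `y`. -/
theorem fract_eq_sub_sum {y : ℝ} (hy : 0 ≤ y) {N : ℕ} (hN : y < N + 1) :
    Int.fract y = y - ∑ n ∈ Finset.range N, if (n + 1 : ℝ) ≤ y then (1 : ℝ) else 0 := by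
  have h1 : (Finset.range N).filter (fun n : ℕ ↦ (n + 1 : ℝ) ≤ y) = Finset.range ⌊y⌋₊ := by
    ext n
    have h2 : (n + 1 : ℝ) ≤ y ↔ n + 1 ≤ ⌊y⌋₊ := by
      rw [Nat.le_floor_iff hy]
      push_cast
      rfl
    have h3 : ⌊y⌋₊ < N + 1 := (Nat.floor_lt hy).2 (by exact_mod_cast hN)
    simp only [Finset.mem_filter, Finset.mem_range, h2]
    omega
  rw [← Finset.sum_filter, h1, Finset.sum_const, Finset.card_range, nsmul_one,
    natCast_floor_eq_intCast_floor hy, Int.self_sub_floor]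

theorem hasDerivAt_exp_half_mul {ψ : ℝ → ℂ} (hψ : ContDiff ℝ 1 ψ) (u : ℝ) :
    HasDerivAt (fun u : ℝ ↦ (Real.exp (u / 2) : ℂ) * ψ u)
      ((Real.exp (u / 2) : ℂ) * (deriv ψ u + ψ u / 2)) u := by
  have h1 : HasDerivAt (fun u : ℝ ↦ (Real.exp (u / 2) : ℂ)) ((Real.exp (u / 2) * (1 / 2) : ℝ) : ℂ)
      u := ((hasDerivAt_id u).div_const 2).exp.ofReal_comp
  convert! h1.mul (hψ.differentiable one_ne_zero u).hasDerivAt using 1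
  push_cast
  ring

theorem integral_exp_neg_mul_deriv {P : ℝ → ℂ} (hP : ContDiff ℝ 1 P) (hc : HasCompactSupport P) :
    ∫ u, (Real.exp (-u) : ℂ) * deriv P u = ∫ u, (Real.exp (-u) : ℂ) * P u := by
  have he : ∀ u : ℝ, HasDerivAt (fun u : ℝ ↦ (Real.exp (-u) : ℂ)) (-(Real.exp (-u) : ℂ)) u :=
    fun u ↦ by
      convert! (hasDerivAt_neg u).exp.ofReal_comp using 1
      push_cast
      ring
  have hce : Continuous fun u : ℝ ↦ (Real.exp (-u) : ℂ) := by fun_prop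
  have hP' : Continuous (deriv P) := hP.continuous_deriv le_rfl
  have h1 : Integrable fun u : ℝ ↦ (Real.exp (-u) : ℂ) * deriv P u :=
    (hce.mul hP').integrable_of_hasCompactSupport hc.deriv.mul_left
  have h2 : Integrable fun u : ℝ ↦ -(Real.exp (-u) : ℂ) * P u :=
    (hce.neg.mul hP.continuous).integrable_of_hasCompactSupport hc.mul_left
  have h3 : Integrable fun u : ℝ ↦ (Real.exp (-u) : ℂ) * P u :=
    (hce.mul hP.continuous).integrable_of_hasCompactSupport hc.mul_left
  have := integral_mul_deriv_eq_deriv_mul_of_integrable (fun u _ ↦ he u)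
    (fun u _ ↦ (hP.differentiable one_ne_zero u).hasDerivAt) h1 h2 h3
  rw [this, ← integral_neg]
  simp

/-- The transposed kernel applied to `ψ' + ψ/2` is, up to sign, a modified co-sum. -/
theorem dualConv_deriv_add {ψ : ℝ → ℂ} (hψ : ContDiff ℝ 1 ψ) (hc : HasCompactSupport ψ)
    {R v : ℝ} {N : ℕ} (hR : ∀ u ∈ tsupport ψ, R ≤ u) (hN : Real.exp (v - R) < N + 1) :
    dualConv (fun u ↦ deriv ψ u + ψ u / 2) v =
      (Real.exp (v / 2) : ℂ) * (∫ u, (Real.exp (-u / 2) : ℂ) * ψ u) -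
        ∑ n ∈ Finset.range N,
          (Real.exp (-Real.log (n + 1) / 2) : ℂ) * ψ (v - Real.log (n + 1)) := by
  -- The integrating factor: `P' = e^{u/2}(ψ' + ψ/2)`.
  set P : ℝ → ℂ := fun u ↦ (Real.exp (u / 2) : ℂ) * ψ u with hPdef
  have hP : ContDiff ℝ 1 P :=
    (Complex.ofRealCLM.contDiff.comp (Real.contDiff_exp.comp (contDiff_id.div_const 2))).mul hψ
  have hPc : HasCompactSupport P := hc.mul_left
  have hP' : ∀ u, deriv P u = (Real.exp (u / 2) : ℂ) * (deriv ψ u + ψ u / 2) :=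
    fun u ↦ (hasDerivAt_exp_half_mul hψ u).deriv
  have hPi : Integrable (deriv P) :=
    (hP.continuous_deriv le_rfl).integrable_of_hasCompactSupport hPc.deriv
  have hei : Integrable fun u : ℝ ↦ (Real.exp (-u) : ℂ) * deriv P u :=
    (Continuous.mul (by fun_prop) (hP.continuous_deriv le_rfl)).integrable_of_hasCompactSupport
      hPc.deriv.mul_left
  -- Split `{e^{v-u}}` into its linear part and unit steps. The linear part pairs `e^{-u}` with
  -- `P'`, and each step `n + 1 ≤ e^{v-u}` restricts `P'` to the half-line `u ≤ v - log(n + 1)`.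
  have key : ∀ u, fractKernel (v - u) * (deriv ψ u + ψ u / 2) =
      (Real.exp (v / 2) : ℂ) * ((Real.exp (-u) : ℂ) * deriv P u) -
        ∑ n ∈ Finset.range N, (Real.exp (-v / 2) : ℂ) *
          (Iic (v - Real.log (n + 1))).indicator (deriv P) u := by
    intro u
    by_cases hu : u ∈ tsupport ψ
    · have hy : Real.exp (v - u) < N + 1 :=
        (Real.exp_le_exp.2 (by linarith [hR u hu])).trans_lt hN
      have hind : ∀ n : ℕ, (Iic (v - Real.log (n + 1))).indicator (deriv P) u =
          ((if (n + 1 : ℝ) ≤ Real.exp (v - u) then (1 : ℝ) else 0 : ℝ) : ℂ) * deriv P u := by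
        intro n
        have : u ∈ Iic (v - Real.log (n + 1)) ↔ (n + 1 : ℝ) ≤ Real.exp (v - u) := by
          rw [← Real.log_le_iff_le_exp (by positivity), mem_Iic]
          constructor <;> intro <;> linarith
        by_cases h : (n + 1 : ℝ) ≤ Real.exp (v - u)
        · simp [indicator_of_mem (this.2 h), h]
        · simp [indicator_of_notMem (this.not.2 h), h]
      simp only [hind, ← Finset.mul_sum, ← Finset.sum_mul, ← Complex.ofReal_sum]
      rw [fractKernel, fract_eq_sub_sum (Real.exp_pos _).le hy, hP']
      generalize (∑ n ∈ Finset.range N, if (n + 1 : ℝ) ≤ Real.exp (v - u) then (1 : ℝ) else 0) = A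
      have e1 : Real.exp (-(v - u) / 2) * Real.exp (v - u) =
          Real.exp (v / 2) * (Real.exp (-u) * Real.exp (u / 2)) := by
        simp only [← Real.exp_add]
        congr 1
        ring
      have e2 : Real.exp (-(v - u) / 2) = Real.exp (-v / 2) * Real.exp (u / 2) := by
        simp only [← Real.exp_add]
        congr 1
        ring
      have e1' := congrArg Complex.ofReal e1
      have e2' := congrArg Complex.ofReal e2
      push_cast at e1' e2' ⊢
      linear_combination (deriv ψ u + ψ u / 2) * e1' - (A : ℂ) * (deriv ψ u + ψ u / 2) * e2'
    · have h0 : deriv ψ u + ψ u / 2 = 0 := by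
        rw [image_eq_zero_of_notMem_tsupport hu,
          image_eq_zero_of_notMem_tsupport fun h ↦ hu (tsupport_deriv_subset h)]
        simp
      have h1 : deriv P u = 0 := by rw [hP', h0, mul_zero]
      have h2 : ∀ s : Set ℝ, s.indicator (deriv P) u = 0 := fun s ↦ by
        by_cases h : u ∈ s <;> simp [h, h1]
      simp [h0, h1, h2]
  have hterm : ∀ n ∈ Finset.range N, Integrable fun u ↦ (Real.exp (-v / 2) : ℂ) *
      (Iic (v - Real.log (n + 1))).indicator (deriv P) u :=
    fun n _ ↦ (hPi.indicator measurableSet_Iic).const_mul _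
  rw [dualConv]
  simp only [key]
  rw [integral_sub (hei.const_mul _) (integrable_finsetSum _ hterm), integral_const_mul,
    integral_exp_neg_mul_deriv hP hPc, integral_finsetSum _ hterm]
  congr 1
  · congr 2
    ext u
    rw [hPdef, ← mul_assoc, ← Complex.ofReal_mul, ← Real.exp_add]
    congr 4
    ring
  -- The integral of `P'` over the half-line is its endpoint value `P(v - log(n + 1))`.
  · refine Finset.sum_congr rfl fun n _ ↦ ?_
    rw [integral_const_mul, integral_indicator measurableSet_Iic,
      hPc.integral_Iic_deriv_eq hP, hPdef, ← mul_assoc, ← Complex.ofReal_mul, ← Real.exp_add]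
    congr 4
    ring

/-! ### The truncated sums and their pairing with test functions. -/

/-- The part of `logSide f` over `]0, Λ]`. -/
def truncLogSide (f : ℝ → ℂ) (Λ : ℝ) : ℝ → ℂ := (Iic (Real.log Λ)).indicator (logSide f)

theorem memLp_truncLogSide {f : ℝ → ℂ} (hf : MemLp f 2 (volume.restrict (Ioi (0 : ℝ)))) (Λ : ℝ) :
    MemLp (truncLogSide f Λ) 2 :=
  (memLp_logSide hf).indicator measurableSet_Iic

/-- Below the cutoff `e^{v/2}` is square integrable, so this is a product of two `L²` functions. -/
theorem integrable_exp_mul_truncLogSide {f : ℝ → ℂ}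
    (hf : MemLp f 2 (volume.restrict (Ioi (0 : ℝ)))) (Λ : ℝ) :
    Integrable fun v : ℝ ↦ (Real.exp (v / 2) : ℂ) * truncLogSide f Λ v := by
  have h1 : MemLp ((Iic (Real.log Λ)).indicator fun v : ℝ ↦ (Real.exp (v / 2) : ℂ)) 2 := by
    rw [memLp_indicator_iff_restrict measurableSet_Iic, memLp_two_iff_integrable_sq_norm
      (Continuous.aestronglyMeasurable (by fun_prop))]
    refine (integrableOn_exp_mul_Iic one_pos (Real.log Λ)).congr (Eventually.of_forall fun v ↦ ?_)
    simp only [Complex.norm_real, Real.norm_eq_abs, Real.abs_exp, ← Real.exp_nat_mul]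
    congr 1
    push_cast
    ring
  refine (h1.integrable_mul (memLp_truncLogSide hf Λ)).congr (Eventually.of_forall fun v ↦ ?_)
  by_cases h : v ≤ Real.log Λ <;> simp [truncLogSide, h]

theorem integral_eq_integral_truncLogSide (f : ℝ → ℂ) {Λ : ℝ} (hΛ : 0 < Λ) :
    ∫ t in (0 : ℝ)..Λ, f t = ∫ v, (Real.exp (v / 2) : ℂ) * truncLogSide f Λ v := by
  rw [intervalIntegral.integral_of_le hΛ.le, ← Ioi_inter_Iic,
    ← setIntegral_indicator measurableSet_Iic, integral_Ioi_zero_eq_integral_exp]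
  congr 1
  ext v
  have : Real.exp v ∈ Iic Λ ↔ v ∈ Iic (Real.log Λ) := (Real.le_log_iff_exp_le hΛ).symm
  by_cases h : v ∈ Iic (Real.log Λ)
  · rw [indicator_of_mem (this.2 h), truncLogSide, indicator_of_mem h, logSide, ← mul_assoc,
      ← Complex.ofReal_mul, ← Real.exp_add, add_halves]
  · rw [indicator_of_notMem (this.not.2 h), truncLogSide, indicator_of_notMem h, mul_zero, mul_zero]

/-- The condition `nx ≤ Λ` is absorbed in the cutoff of `h`, so the range of summation may be any `N
≥ ⌊Λ/x⌋`, hence constant on sets of `u` bounded below. -/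
theorem exp_mul_truncSum (f : ℝ → ℂ) {Λ u : ℝ} (hΛ : 0 < Λ) {N : ℕ}
    (hN : Real.exp (Real.log Λ - u) < N + 1) :
    (Real.exp (u / 2) : ℂ) * truncSum f Λ (Real.exp u) =
      ∑ n ∈ Finset.range N, (Real.exp (-Real.log (n + 1) / 2) : ℂ) *
          truncLogSide f Λ (u + Real.log (n + 1)) -
        (Real.exp (-u / 2) : ℂ) * ∫ v, (Real.exp (v / 2) : ℂ) * truncLogSide f Λ v := by
  have hq : Real.exp (Real.log Λ - u) = Λ / Real.exp u := by rw [Real.exp_sub, Real.exp_log hΛ]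
  rw [hq] at hN
  have hq0 : 0 ≤ Λ / Real.exp u := by positivity
  rw [truncSum, mul_sub, integral_eq_integral_truncLogSide f hΛ]
  congr 1
  · have hsub : ⌊Λ / Real.exp u⌋₊ ≤ N :=
      Nat.lt_succ_iff.1 ((Nat.floor_lt hq0).2 (by exact_mod_cast hN))
    have hterm : ∀ n : ℕ, (Real.exp (-Real.log (n + 1) / 2) : ℂ) *
        truncLogSide f Λ (u + Real.log (n + 1)) =
        if n < ⌊Λ / Real.exp u⌋₊ then
          (Real.exp (u / 2) : ℂ) * f (((n + 1 : ℕ) : ℝ) * Real.exp u) else 0 := by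
      intro n
      have hn : (0 : ℝ) < n + 1 := by positivity
      have hiff : u + Real.log (n + 1) ∈ Iic (Real.log Λ) ↔ n < ⌊Λ / Real.exp u⌋₊ := by
        rw [Nat.lt_iff_add_one_le, Nat.le_floor_iff hq0, le_div_iff₀ (Real.exp_pos u), mem_Iic,
          Real.le_log_iff_exp_le hΛ, Real.exp_add, Real.exp_log hn, mul_comm]
        push_cast
        rfl
      by_cases h : n < ⌊Λ / Real.exp u⌋₊
      · rw [if_pos h, truncLogSide, indicator_of_mem (hiff.2 h), logSide, Real.exp_add u,
          Real.exp_log hn, ← mul_assoc, ← Complex.ofReal_mul, ← Real.exp_add]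
        push_cast
        rw [mul_comm (Real.exp u)]
        congr 3
        ring
      · rw [if_neg h, truncLogSide, indicator_of_notMem (hiff.not.2 h), mul_zero]
    simp only [hterm]
    rw [← Finset.sum_filter, Finset.mul_sum, Finset.range_eq_Ico, ← Finset.Ico_add_one_right_eq_Icc,
      Finset.sum_Ico_eq_sum_range, Nat.add_sub_cancel]
    have : (Finset.Ico 0 N).filter (fun n ↦ n < ⌊Λ / Real.exp u⌋₊) =
        Finset.range ⌊Λ / Real.exp u⌋₊ := by
      ext n
      simp only [Finset.mem_filter, Finset.mem_Ico, Finset.mem_range]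
      omega
    rw [this]
    simp only [add_comm 1]
  · rw [mul_div_left_comm, mul_comm (Real.exp (-u / 2) : ℂ)]
    congr 1
    rw [← Complex.ofReal_div, ← Real.exp_sub]
    congr 2
    ring

theorem locallyIntegrable_exp_mul_truncSum {f : ℝ → ℂ}
    (hf : MemLp f 2 (volume.restrict (Ioi (0 : ℝ)))) {Λ : ℝ} (hΛ : 0 < Λ) :
    LocallyIntegrable (fun u : ℝ ↦ (Real.exp (u / 2) : ℂ) * truncSum f Λ (Real.exp u)) := by
  intro u₀
  -- Chosen at the left end of the neighbourhood, where `Λ/x` is largest.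
  obtain ⟨N, hN⟩ := exists_nat_gt (Real.exp (Real.log Λ - (u₀ - 1)))
  have hloc : LocallyIntegrable fun u : ℝ ↦
      ∑ n ∈ Finset.range N, (Real.exp (-Real.log (n + 1) / 2) : ℂ) *
          truncLogSide f Λ (u + Real.log (n + 1)) -
        (Real.exp (-u / 2) : ℂ) * ∫ v, (Real.exp (v / 2) : ℂ) * truncLogSide f Λ v := by
    refine LocallyIntegrable.sub (locallyIntegrable_finsetSum _ fun n _ ↦ ?_)
      (Continuous.locallyIntegrable (by fun_prop))
    refine MemLp.locallyIntegrable (p := 2) ?_ (by norm_num)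
    exact ((memLp_truncLogSide hf Λ).comp_measurePreserving
      (measurePreserving_add_right volume _)).const_mul _
  refine ⟨Icc (u₀ - 1) (u₀ + 1), Icc_mem_nhds (by linarith) (by linarith), ?_⟩
  refine (hloc.integrableOn_isCompact isCompact_Icc).congr_fun (fun u hu ↦ ?_) measurableSet_Icc
  refine (exp_mul_truncSum f hΛ (lt_of_le_of_lt ?_ (hN.trans (lt_add_one _)))).symm
  exact Real.exp_le_exp.2 (by linarith [hu.1])

/-- Both sides expand into finite sums whose terms match after the translation by `log(n + 1)`. -/
theorem integral_truncSum_mul {f : ℝ → ℂ} (hf : MemLp f 2 (volume.restrict (Ioi (0 : ℝ))))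
    {Λ : ℝ} (hΛ : 0 < Λ) {ψ : ℝ → ℂ} (hψ : ContDiff ℝ 1 ψ) (hc : HasCompactSupport ψ) :
    ∫ u, (Real.exp (u / 2) : ℂ) * truncSum f Λ (Real.exp u) * ψ u =
      -∫ v, truncLogSide f Λ v * dualConv (fun u ↦ deriv ψ u + ψ u / 2) v := by
  obtain ⟨R, hR⟩ : ∃ R, ∀ u ∈ tsupport ψ, R ≤ u := hc.isCompact.bddBelow
  -- Since `v ≤ log Λ` on the cutoff and `u ≥ R` on the support of `ψ`, one `N` bounds the number of
  -- terms on both sides.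
  obtain ⟨N, hN'⟩ := exists_nat_gt (Real.exp (Real.log Λ - R))
  have hN : Real.exp (Real.log Λ - R) < N + 1 := hN'.trans (lt_add_one _)
  have hψ2 : MemLp ψ 2 := hψ.continuous.memLp_of_hasCompactSupport hc
  set I := ∫ v, (Real.exp (v / 2) : ℂ) * truncLogSide f Λ v with hI
  set J := ∫ u, (Real.exp (-u / 2) : ℂ) * ψ u with hJ
  have hL : ∀ u, (Real.exp (u / 2) : ℂ) * truncSum f Λ (Real.exp u) * ψ u =
      ∑ n ∈ Finset.range N, (Real.exp (-Real.log (n + 1) / 2) : ℂ) *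
        (truncLogSide f Λ (u + Real.log (n + 1)) * ψ u) - I * ((Real.exp (-u / 2) : ℂ) * ψ u) := by
    intro u
    by_cases hu : u ∈ tsupport ψ
    · rw [exp_mul_truncSum f hΛ (N := N)
        ((Real.exp_le_exp.2 (by linarith [hR u hu])).trans_lt hN), sub_mul, Finset.sum_mul]
      congr 1
      · exact Finset.sum_congr rfl fun n _ ↦ mul_assoc _ _ _
      · ring
    · simp [image_eq_zero_of_notMem_tsupport hu]
  have hRt : ∀ v, truncLogSide f Λ v * dualConv (fun u ↦ deriv ψ u + ψ u / 2) v =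
      J * ((Real.exp (v / 2) : ℂ) * truncLogSide f Λ v) -
      ∑ n ∈ Finset.range N, (Real.exp (-Real.log (n + 1) / 2) : ℂ) *
        (truncLogSide f Λ v * ψ (v - Real.log (n + 1))) := by
    intro v
    by_cases hv : v ≤ Real.log Λ
    · rw [dualConv_deriv_add hψ hc hR
        ((Real.exp_le_exp.2 (by linarith)).trans_lt hN), mul_sub, Finset.mul_sum]
      congr 1
      · ring
      · exact Finset.sum_congr rfl fun n _ ↦ by ring
    · simp [truncLogSide, hv]
  have hi1 : ∀ n ∈ Finset.range N, Integrable fun u ↦ (Real.exp (-Real.log (n + 1) / 2) : ℂ) *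
      (truncLogSide f Λ (u + Real.log (n + 1)) * ψ u) := fun n _ ↦
    (((memLp_truncLogSide hf Λ).comp_measurePreserving
      (measurePreserving_add_right volume _)).integrable_mul hψ2).const_mul _
  have hi2 : ∀ n ∈ Finset.range N, Integrable fun v ↦ (Real.exp (-Real.log (n + 1) / 2) : ℂ) *
      (truncLogSide f Λ v * ψ (v - Real.log (n + 1))) := fun n _ ↦
    ((memLp_truncLogSide hf Λ).integrable_mul (hψ2.comp_measurePreserving
      (measurePreserving_sub_right volume _))).const_mul _
  have hi3 : Integrable fun u ↦ (Real.exp (-u / 2) : ℂ) * ψ u :=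
    (Continuous.mul (by fun_prop) hψ.continuous).integrable_of_hasCompactSupport hc.mul_left
  simp only [hL, hRt]
  rw [integral_sub (integrable_finsetSum _ hi1) (hi3.const_mul _),
    integral_sub ((integrable_exp_mul_truncLogSide hf Λ).const_mul _) (integrable_finsetSum _ hi2),
    integral_const_mul, integral_const_mul, ← hI, ← hJ, mul_comm J I, neg_sub,
    integral_finsetSum _ hi1, integral_finsetSum _ hi2]
  congr 1
  refine Finset.sum_congr rfl fun n _ ↦ ?_
  rw [integral_const_mul, integral_const_mul, ← integral_sub_right_eq_self _ (Real.log (n + 1))]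
  simp only [sub_add_cancel]

/-- This is `dualConv_deriv_add` read in the variable `x`; the lower bound on the support makes the
series finite. -/
theorem exp_mul_coSum (φ : 𝓓(halfLine, ℂ)) (v : ℝ) :
    (Real.exp (v / 2) : ℂ) * coSum φ (Real.exp v) =
      -dualConv (fun u ↦ deriv (logPullback φ) u + logPullback φ u / 2) v := by
  have hc : HasCompactSupport (logPullback φ) := hasCompactSupport_logPullback φ
  have hψ : ContDiff ℝ 1 (logPullback φ) := (contDiff_logPullback φ).of_le (by simp)
  obtain ⟨R, hR⟩ : ∃ R, ∀ u ∈ tsupport (logPullback φ), R ≤ u := hc.isCompact.bddBelow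
  obtain ⟨N, hN'⟩ := exists_nat_gt (Real.exp (v - R))
  have hN : Real.exp (v - R) < N + 1 := hN'.trans (lt_add_one _)
  have hterm : ∀ n : ℕ, (Real.exp (-Real.log (n + 1) / 2) : ℂ) *
      logPullback φ (v - Real.log (n + 1)) =
      (Real.exp (v / 2) : ℂ) * (φ (Real.exp v / (n + 1)) / ((n : ℂ) + 1)) := by
    intro n
    have hn : (0 : ℝ) < n + 1 := by positivity
    have e : Real.exp (-Real.log (n + 1) / 2) * Real.exp ((v - Real.log (n + 1)) / 2) =
        Real.exp (v / 2) / (n + 1) := by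
      rw [← Real.exp_add, ← Real.exp_log hn, ← Real.exp_sub, Real.log_exp]
      congr 1
      ring
    have e' := congrArg Complex.ofReal e
    rw [logPullback_apply, Real.exp_sub v, Real.exp_log hn]
    push_cast at e' ⊢
    linear_combination φ (Real.exp v / (n + 1)) * e'
  have hint : ∫ t in Ioi (0 : ℝ), φ (1 / t) / (t : ℂ) =
      ∫ u, (Real.exp (-u / 2) : ℂ) * logPullback φ u := by
    rw [integral_Ioi_zero_eq_integral_exp, ← integral_neg_eq_self]
    congr 1
    ext u
    have h1 : (Real.exp (-u) : ℂ) ≠ 0 := by exact_mod_cast (Real.exp_pos _).ne'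
    rw [mul_div_cancel₀ _ h1, logPullback_apply, ← mul_assoc, ← Complex.ofReal_mul, ← Real.exp_add,
      one_div, ← Real.exp_neg, neg_neg]
    simp [neg_div]
  have hz : ∀ n ∉ Finset.range N, (Real.exp (v / 2) : ℂ) *
      (φ (Real.exp v / (n + 1)) / ((n : ℂ) + 1)) = 0 := by
    intro n hn
    suffices v - Real.log (n + 1) ∉ tsupport (logPullback φ) by
      rw [← hterm, image_eq_zero_of_notMem_tsupport this, mul_zero]
    intro hmem
    have h1 := hR _ hmem
    have h2 : Real.log (n + 1) ≤ v - R := by linarith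
    rw [Real.log_le_iff_le_exp (by positivity)] at h2
    have h3 : (N : ℝ) ≤ n := by exact_mod_cast not_lt.1 (Finset.mem_range.not.1 hn)
    linarith
  rw [dualConv_deriv_add hψ hc hR hN, coSum, mul_sub, hint, neg_sub, ← tsum_mul_left,
    tsum_eq_sum hz]
  simp only [hterm]

/-! ### The multiplier `ζ(1/2 + iτ)` on the Fourier side. -/

theorem integral_fractKernel_mul_exp (τ : ℝ) :
    ∫ w, fractKernel w * Complex.exp (-(Complex.I * τ * w)) =
      -riemannZeta (1 / 2 + (τ : ℂ) * Complex.I) / (1 / 2 + (τ : ℂ) * Complex.I) := by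
  rw [← integral_Ioi_zero_fract_mul_cpow (by simp) (by simp; norm_num), integral_Ioi_zero_eq_integral_exp]
  congr 1
  ext w
  have h0 : (Real.exp w : ℂ) ≠ 0 := by exact_mod_cast (Real.exp_pos w).ne'
  have e : (Real.exp w : ℂ) * (Real.exp w : ℂ) ^ (-(1 / 2 + (τ : ℂ) * Complex.I + 1)) =
      (Real.exp (-w / 2) : ℂ) * Complex.exp (-(Complex.I * τ * w)) := by
    rw [Complex.cpow_def_of_ne_zero h0, ← Complex.ofReal_log (Real.exp_pos w).le, Real.log_exp,
      Complex.ofReal_exp, Complex.ofReal_exp, ← Complex.exp_add, ← Complex.exp_add]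
    congr 1
    push_cast
    ring
  rw [fractKernel]
  push_cast at e ⊢
  linear_combination -((Int.fract (Real.exp w) : ℝ) : ℂ) * e

/-- Differentiation under the integral sign brings down `iτ`; the added half completes it to `s`. -/
theorem deriv_expTransform_add (θ : 𝓢(ℝ, ℂ)) (hθ : HasCompactSupport θ) (u : ℝ) :
    deriv (expTransform θ) u + expTransform θ u / 2 =
      ∫ τ : ℝ, (1 / 2 + (τ : ℂ) * Complex.I) * θ τ * Complex.exp (Complex.I * τ * u) := by
  have hcθ := θ.continuous
  have hn : ∀ τ u : ℝ, ‖Complex.exp (Complex.I * τ * u)‖ = 1 := fun τ u ↦ by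
    rw [mul_assoc, ← Complex.ofReal_mul, mul_comm, Complex.norm_exp_ofReal_mul_I]
  have hi : ∀ u : ℝ, Integrable fun τ : ℝ ↦ θ τ * Complex.exp (Complex.I * τ * u) := fun u ↦
    (Continuous.mul hcθ (by fun_prop)).integrable_of_hasCompactSupport hθ.mul_right
  have hi' : Integrable fun τ : ℝ ↦ Complex.I * τ * θ τ :=
    (Continuous.mul (by fun_prop) hcθ).integrable_of_hasCompactSupport hθ.mul_left
  have hd := (hasDerivAt_integral_of_dominated_loc_of_deriv_le (μ := volume) (𝕜 := ℝ) (x₀ := u)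
    (F := fun u τ ↦ θ τ * Complex.exp (Complex.I * (τ : ℝ) * u))
    (F' := fun u τ ↦ θ τ * (Complex.exp (Complex.I * (τ : ℝ) * u) * (Complex.I * τ)))
    (bound := fun τ ↦ ‖Complex.I * τ * θ τ‖) univ_mem
    (Eventually.of_forall fun u ↦ (hi u).aestronglyMeasurable) (hi u)
    (Continuous.aestronglyMeasurable (by fun_prop))
    (Eventually.of_forall fun τ v _ ↦ by
      simp only [norm_mul, hn, one_mul]
      rw [mul_comm])
    hi'.norm
    (Eventually.of_forall fun τ v _ ↦ by
      have h1 : HasDerivAt (fun v : ℝ ↦ Complex.I * τ * (v : ℂ)) (Complex.I * τ) v := by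
        simpa using (Complex.ofRealCLM.hasDerivAt (x := v)).const_mul (Complex.I * (τ : ℂ))
      exact h1.cexp.const_mul (θ τ))).2
  have hfun : (expTransform θ : ℝ → ℂ) =
      fun u : ℝ ↦ ∫ τ : ℝ, θ τ * Complex.exp (Complex.I * τ * u) :=
    funext fun u ↦ expTransform_apply θ u
  have hi2 : Integrable fun τ : ℝ ↦ θ τ * (Complex.exp (Complex.I * τ * u) * (Complex.I * τ)) :=
    (Continuous.mul hcθ (by fun_prop)).integrable_of_hasCompactSupport hθ.mul_right
  rw [hfun, hd.deriv, ← integral_div, ← integral_add hi2 ((hi u).div_const 2)]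
  congr 1
  ext τ
  ring

/-- The only pole, `s = 1`, is off the critical line. Hence multiplication by `ζ` preserves
compactly supported test functions. -/
theorem contDiff_riemannZeta_critical :
    ContDiff ℝ ∞ fun τ : ℝ ↦ riemannZeta (1 / 2 + (τ : ℂ) * Complex.I) := by
  rw [contDiff_iff_contDiffAt]
  intro τ
  have hne : (1 / 2 + (τ : ℂ) * Complex.I) ∈ ({1}ᶜ : Set ℂ) := fun h ↦ by
    have := congrArg Complex.re h
    norm_num at this
  have h1 : ContDiffAt ℂ ∞ riemannZeta (1 / 2 + (τ : ℂ) * Complex.I) :=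
    (differentiableOn_riemannZeta.contDiffOn isOpen_compl_singleton).contDiffAt
      (isOpen_compl_singleton.mem_nhds hne)
  have h2 : ContDiffAt ℝ ∞ (fun τ : ℝ ↦ 1 / 2 + (τ : ℂ) * Complex.I) τ :=
    contDiffAt_const.add (Complex.ofRealCLM.contDiff.contDiffAt.mul contDiffAt_const)
  exact (h1.restrict_scalars ℝ).comp τ h2

/-- The product of a test function with `τ ↦ ζ(1/2 + iτ)`. -/
def zetaMul (θ : 𝓢(ℝ, ℂ)) (hθ : HasCompactSupport θ) : 𝓢(ℝ, ℂ) :=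
  HasCompactSupport.toSchwartzMap
    (f := fun τ : ℝ ↦ riemannZeta (1 / 2 + (τ : ℂ) * Complex.I) * θ τ) hθ.mul_left
    (contDiff_riemannZeta_critical.mul (θ.smooth ⊤))

theorem zetaMul_apply (θ : 𝓢(ℝ, ℂ)) (hθ : HasCompactSupport θ) (τ : ℝ) :
    zetaMul θ hθ τ = riemannZeta (1 / 2 + (τ : ℂ) * Complex.I) * θ τ := rfl

/-- Exponentials are eigenfunctions of the convolution, with eigenvalue `-ζ(s)/s`, and the factor
`s` from `∂ + 1/2` cancels the denominator. -/
theorem dualConv_expTransform (θ : 𝓢(ℝ, ℂ)) (hθ : HasCompactSupport θ) (v : ℝ) :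
    dualConv (fun u ↦ deriv (expTransform θ) u + expTransform θ u / 2) v =
      -expTransform (zetaMul θ hθ) v := by
  set ρ : ℝ → ℂ := fun τ ↦ (1 / 2 + (τ : ℂ) * Complex.I) * θ τ with hρ
  have hρi : Integrable ρ :=
    (Continuous.mul (by fun_prop) θ.continuous).integrable_of_hasCompactSupport hθ.mul_left
  have hki : Integrable fun u ↦ fractKernel (v - u) := integrable_fractKernel.comp_sub_left v
  have hprod : Integrable (fun p : ℝ × ℝ ↦
      fractKernel (v - p.1) * ρ p.2 * Complex.exp (Complex.I * p.2 * p.1))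
      (volume.prod volume) := by
    refine (hki.mul_prod hρi).mul_bdd (c := 1)
      (Continuous.aestronglyMeasurable (by fun_prop)) (Eventually.of_forall fun p ↦ ?_)
    rw [mul_assoc, ← Complex.ofReal_mul, mul_comm, Complex.norm_exp_ofReal_mul_I]
  simp only [dualConv, deriv_expTransform_add θ hθ]
  calc ∫ u, fractKernel (v - u) * ∫ τ : ℝ, ρ τ * Complex.exp (Complex.I * τ * u)
      = ∫ u, ∫ τ : ℝ, fractKernel (v - u) * ρ τ * Complex.exp (Complex.I * τ * u) := by
        simp only [mul_assoc, integral_const_mul]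
    _ = ∫ τ : ℝ, ∫ u, fractKernel (v - u) * ρ τ * Complex.exp (Complex.I * τ * u) :=
        integral_integral_swap hprod
    _ = -expTransform (zetaMul θ hθ) v := by
        rw [expTransform_apply, ← integral_neg]
        congr 1
        ext τ
        have hs : (1 / 2 + (τ : ℂ) * Complex.I) ≠ 0 := fun h ↦ by
          have := congrArg Complex.re h
          norm_num at this
        have h1 : ∀ u : ℝ, fractKernel (v - u) * ρ τ * Complex.exp (Complex.I * τ * u) =
            ρ τ * Complex.exp (Complex.I * τ * v) *
              (fractKernel (v - u) * Complex.exp (-(Complex.I * τ * ((v - u : ℝ) : ℂ)))) :=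
          fun u ↦ by
            have : Complex.exp (Complex.I * τ * u) = Complex.exp (Complex.I * τ * v) *
                Complex.exp (-(Complex.I * τ * ((v - u : ℝ) : ℂ))) := by
              rw [← Complex.exp_add]
              congr 1
              push_cast
              ring
            rw [this]
            ring
        simp only [h1]
        rw [integral_const_mul, integral_sub_left_eq_self
          (fun w : ℝ ↦ fractKernel w * Complex.exp (-(Complex.I * τ * (w : ℂ)))) volume v,
          integral_fractKernel_mul_exp, zetaMul_apply, show ρ τ = _ * θ τ from rfl]
        generalize 1 / 2 + (τ : ℂ) * Complex.I = s at hs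
        field_simp

/-! ### The Mellin–Plancherel transform. -/

/-- The `L²` transform and the integral agree because, tested against smooth compactly supported
functions, both move the transform onto the test function. -/
theorem fourierInv_toLp_ae_eq {p : ℝ → ℂ} (hp : MemLp p 2) (hi : Integrable p) :
    (𝓕⁻ (hp.toLp p) : Lp ℂ 2 (volume : Measure ℝ)) =ᵐ[volume] 𝓕⁻ p := by
  have hcont : Continuous (𝓕⁻ p) := by
    rw [Real.fourierInv_eq_fourier_comp_neg]
    exact VectorFourier.fourierIntegral_continuous Real.continuous_fourierChar
      (by fun_prop) hi.comp_neg
  refine ae_eq_of_integral_contDiff_smul_eq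
    ((Lp.memLp _).locallyIntegrable (by norm_num)) hcont.locallyIntegrable fun g hg hgc ↦ ?_
  have hgc' : HasCompactSupport fun x ↦ (g x : ℂ) := hgc.comp_left (g := Complex.ofReal) rfl
  set θ : 𝓢(ℝ, ℂ) := hgc'.toSchwartzMap (Complex.ofRealCLM.contDiff.comp hg) with hθ
  have h1 := congrArg (fun T : 𝓢'(ℝ, ℂ) ↦ T θ)
    (Lp.fourierInv_toTemperedDistribution_eq (hp.toLp p))
  simp only [TemperedDistribution.fourierInv_apply, Lp.toTemperedDistribution_apply] at h1
  have h2 : ∀ x, g x • (𝓕⁻ (hp.toLp p) : Lp ℂ 2 (volume : Measure ℝ)) x =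
      θ x • (𝓕⁻ (hp.toLp p) : Lp ℂ 2 (volume : Measure ℝ)) x := fun x ↦ rfl
  have h3 : ∀ x, g x • 𝓕⁻ p x = θ x • 𝓕⁻ p x := fun x ↦ rfl
  simp only [h2, h3]
  rw [← h1]
  have h4 : ∫ x, 𝓕⁻ θ x • (hp.toLp p) x = ∫ x, 𝓕⁻ θ x • p x := by
    refine integral_congr_ae ?_
    filter_upwards [hp.coeFn_toLp] with x hx
    rw [hx]
  rw [h4]
  have h5 := VectorFourier.integral_fourierIntegral_smul_eq_flip (L := -innerₗ ℝ) (f := θ) (g := p)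
    Real.continuous_fourierChar continuous_inner.neg (θ.integrable (μ := volume)) hi
  have h6 : (-innerₗ ℝ : ℝ →ₗ[ℝ] ℝ →ₗ[ℝ] ℝ).flip = -innerₗ ℝ := by
    ext
    simp
  rw [h6] at h5
  rw [SchwartzMap.fourierInv_coe]
  exact h5


theorem map_mul_inv_two_pi :
    Measure.map (fun τ : ℝ ↦ τ * (2 * Real.pi)⁻¹) volume =
      ENNReal.ofReal (2 * Real.pi) • (volume : Measure ℝ) := by
  rw [Real.map_volume_mul_right (by positivity), inv_inv, abs_of_pos (by positivity)]

theorem quasiMeasurePreserving_mul_inv_two_pi :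
    Measure.QuasiMeasurePreserving (fun τ : ℝ ↦ τ * (2 * Real.pi)⁻¹) := by
  refine ⟨by fun_prop, ?_⟩
  rw [map_mul_inv_two_pi]
  exact Measure.smul_absolutelyContinuous

/-- The price of passing from the kernel `e^{2πiξu}` to `e^{iτu}`: a finite factor `√(2π)`, harmless
for convergence. -/
theorem eLpNorm_comp_mul_inv_two_pi {q : ℝ → ℂ} (hq : AEStronglyMeasurable q) :
    eLpNorm (fun τ ↦ q (τ * (2 * Real.pi)⁻¹)) 2 volume =
      ENNReal.ofReal (2 * Real.pi) ^ (1 / (2 : ENNReal)).toReal * eLpNorm q 2 volume := by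
  have h := eLpNorm_map_measure (g := q) (p := 2) (f := fun τ : ℝ ↦ τ * (2 * Real.pi)⁻¹)
    (μ := volume) (by rw [map_mul_inv_two_pi]; exact hq.smul_measure _) (by fun_prop)
  rw [map_mul_inv_two_pi, eLpNorm_smul_measure_of_ne_top (by norm_num)] at h
  exact h.symm

/-- The Mellin–Plancherel transform on the critical line, through the Fourier–Plancherel transform
in the variable `log x`. -/
def mellinPlancherel (f : ℝ → ℂ) (hf : MemLp f 2 (volume.restrict (Ioi (0 : ℝ)))) (τ : ℝ) : ℂ :=
  (𝓕⁻ ((memLp_logSide hf).toLp (logSide f)) : Lp ℂ 2 (volume : Measure ℝ)) (τ * (2 * Real.pi)⁻¹)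

theorem memLp_mellinPlancherel {f : ℝ → ℂ} (hf : MemLp f 2 (volume.restrict (Ioi (0 : ℝ)))) :
    MemLp (mellinPlancherel f hf) 2 := by
  have h := Lp.memLp (𝓕⁻ ((memLp_logSide hf).toLp (logSide f)) : Lp ℂ 2 (volume : Measure ℝ))
  refine ⟨h.aestronglyMeasurable.comp_quasiMeasurePreserving
    quasiMeasurePreserving_mul_inv_two_pi, ?_⟩
  have := eLpNorm_comp_mul_inv_two_pi h.aestronglyMeasurable
  rw [show mellinPlancherel f hf = _ from rfl]
  unfold mellinPlancherel
  rw [this]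
  exact ENNReal.mul_lt_top
    (ENNReal.rpow_ne_top_of_nonneg (by positivity) ENNReal.ofReal_ne_top).lt_top h.eLpNorm_lt_top

theorem integrable_indicator_logSide {f : ℝ → ℂ}
    (hf : MemLp f 2 (volume.restrict (Ioi (0 : ℝ)))) (a b : ℝ) :
    Integrable ((Ioc a b).indicator (logSide f)) := by
  rw [integrable_indicator_iff measurableSet_Ioc]
  exact (((memLp_logSide hf).restrict _).integrable (by norm_num))

theorem intervalIntegral_mellin_eq (f : ℝ → ℂ) {a b : ℝ} (ha : 0 < a) (hab : a ≤ b) (τ : ℝ) :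
    ∫ x in a..b, f x * (x : ℂ) ^ ((1 / 2 + (τ : ℂ) * Complex.I) - 1) =
      𝓕⁻ ((Ioc (Real.log a) (Real.log b)).indicator (logSide f)) (τ * (2 * Real.pi)⁻¹) := by
  have hb : 0 < b := ha.trans_le hab
  have hset : Ioc a b = Ioi 0 ∩ Ioc a b :=
    (inter_eq_right.2 fun x hx ↦ ha.trans hx.1).symm
  rw [intervalIntegral.integral_of_le hab, hset, ← setIntegral_indicator measurableSet_Ioc,
    integral_Ioi_zero_eq_integral_exp, Real.fourierInv_eq']
  congr 1
  ext u
  have hiff : Real.exp u ∈ Ioc a b ↔ u ∈ Ioc (Real.log a) (Real.log b) := by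
    rw [mem_Ioc, mem_Ioc, Real.log_lt_iff_lt_exp ha, Real.le_log_iff_exp_le hb]
  by_cases h : u ∈ Ioc (Real.log a) (Real.log b)
  · have h0 : (Real.exp u : ℂ) ≠ 0 := by exact_mod_cast (Real.exp_pos u).ne'
    have hpi : (Real.pi : ℂ) ≠ 0 := by exact_mod_cast Real.pi_ne_zero
    have e : (Real.exp u : ℂ) * (Real.exp u : ℂ) ^ ((1 / 2 + (τ : ℂ) * Complex.I) - 1) =
        Complex.exp (((2 * Real.pi * inner ℝ u (τ * (2 * Real.pi)⁻¹) : ℝ) : ℂ) * Complex.I) *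
          (Real.exp (u / 2) : ℂ) := by
      rw [Complex.cpow_def_of_ne_zero h0, ← Complex.ofReal_log (Real.exp_pos u).le, Real.log_exp,
        Complex.ofReal_exp, Complex.ofReal_exp, ← Complex.exp_add, ← Complex.exp_add]
      congr 1
      simp only [RCLike.inner_apply, conj_trivial]
      push_cast
      field_simp
      ring
    rw [indicator_of_mem (hiff.2 h), indicator_of_mem h, logSide, smul_eq_mul]
    linear_combination f (Real.exp u) * e
  · rw [indicator_of_notMem (hiff.not.2 h), indicator_of_notMem h, mul_zero, smul_zero]

theorem tendsto_eLpNorm_indicator_Ioc_sub {h : ℝ → ℂ} (hh : MemLp h 2) {ι : Type*} {l : Filter ι}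
    [l.IsCountablyGenerated] {a b : ι → ℝ} (ha : Tendsto a l atBot) (hb : Tendsto b l atTop) :
    Tendsto (fun i ↦ eLpNorm ((Ioc (a i) (b i)).indicator h - h) 2 volume) l (𝓝 0) := by
  -- Dominated convergence for `∫⁻` asks for genuine measurability, so a strongly measurable
  -- representative is taken.
  wlog hm : StronglyMeasurable h generalizing h
  · obtain ⟨g, hg, hae⟩ := hh.aestronglyMeasurable
    refine (this (hh.ae_eq hae) hg).congr fun i ↦ eLpNorm_congr_ae ?_
    filter_upwards [hae] with v hv
    by_cases hi : v ∈ Ioc (a i) (b i) <;> simp [hi, hv]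
  have key : Tendsto (fun i ↦ ∫⁻ v, ‖((Ioc (a i) (b i)).indicator h - h) v‖ₑ ^ (2 : ℝ)) l
      (𝓝 (∫⁻ _ : ℝ, 0)) := by
    refine tendsto_lintegral_filter_of_dominated_convergence (fun v ↦ ‖h v‖ₑ ^ (2 : ℝ)) ?_ ?_ ?_ ?_
    · exact Eventually.of_forall fun i ↦
        ((hm.indicator measurableSet_Ioc).sub hm).enorm.pow_const _
    · refine Eventually.of_forall fun i ↦ Eventually.of_forall fun v ↦ ?_
      by_cases hv : v ∈ Ioc (a i) (b i) <;> simp [hv]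
    · exact (lintegral_rpow_enorm_lt_top_of_eLpNorm_lt_top two_ne_zero (by norm_num)
        hh.eLpNorm_lt_top).ne
    · refine Eventually.of_forall fun v ↦ tendsto_const_nhds.congr' ?_
      filter_upwards [ha.eventually_lt_atBot v, hb.eventually_ge_atTop v] with i h1 h2
      simp [h1, h2]
  have := (ENNReal.continuous_rpow_const (y := (1 / 2 : ℝ))).continuousAt.tendsto.comp key
  simpa [eLpNorm_eq_lintegral_rpow_enorm_toReal, Function.comp_def] using this

/-- The partial integrals are transforms of `h` cut to `]log a, log A]`. By isometry the error is,
up to the dilation constant, the `L²` norm of the removed tails. -/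
theorem isMellinPlancherel_mellinPlancherel {f : ℝ → ℂ}
    (hf : MemLp f 2 (volume.restrict (Ioi (0 : ℝ)))) :
    IsMellinPlancherel f (mellinPlancherel f hf) := by
  refine ⟨memLp_mellinPlancherel hf, ?_⟩
  have hh := memLp_logSide hf
  have ha : Tendsto (fun p : ℝ × ℝ ↦ Real.log p.1) (𝓝[>] (0 : ℝ) ×ˢ atTop) atBot :=
    Real.tendsto_log_nhdsGT_zero.comp tendsto_fst
  have hb : Tendsto (fun p : ℝ × ℝ ↦ Real.log p.2) (𝓝[>] (0 : ℝ) ×ˢ atTop) atTop :=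
    Real.tendsto_log_atTop.comp tendsto_snd
  have h0 := ENNReal.Tendsto.const_mul (a := ENNReal.ofReal (2 * Real.pi) ^
    (1 / (2 : ENNReal)).toReal) (tendsto_eLpNorm_indicator_Ioc_sub hh ha hb)
    (Or.inr (ENNReal.rpow_ne_top_of_nonneg (by positivity) ENNReal.ofReal_ne_top))
  rw [mul_zero] at h0
  refine h0.congr' ?_
  have e1 : ∀ᶠ p : ℝ × ℝ in 𝓝[>] (0 : ℝ) ×ˢ atTop, p.1 ∈ Ioo 0 1 :=
    tendsto_fst.eventually (Ioo_mem_nhdsGT one_pos)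
  have e2 : ∀ᶠ p : ℝ × ℝ in 𝓝[>] (0 : ℝ) ×ˢ atTop, 1 ≤ p.2 :=
    tendsto_snd.eventually (eventually_ge_atTop 1)
  filter_upwards [e1, e2] with p hp1 hp2
  set p' := (Ioc (Real.log p.1) (Real.log p.2)).indicator (logSide f) with hp'
  have hmem : MemLp p' 2 := hh.indicator measurableSet_Ioc
  have hint : Integrable p' := integrable_indicator_logSide hf _ _
  simp only [intervalIntegral_mellin_eq f hp1.1 (hp1.2.le.trans hp2), ← hp']
  have hq : AEStronglyMeasurable (fun x ↦ 𝓕⁻ p' x - (𝓕⁻ (hh.toLp (logSide f)) :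
      Lp ℂ 2 (volume : Measure ℝ)) x) :=
    ((Lp.aestronglyMeasurable _).congr (fourierInv_toLp_ae_eq hmem hint)).sub
      (Lp.aestronglyMeasurable _)
  have h1 := eLpNorm_comp_mul_inv_two_pi hq
  simp only [mellinPlancherel]
  rw [h1]
  congr 1
  have h2 : (fun x ↦ 𝓕⁻ p' x - (𝓕⁻ (hh.toLp (logSide f)) : Lp ℂ 2 (volume : Measure ℝ)) x)
      =ᵐ[volume]
      (𝓕⁻ (hmem.toLp p' - hh.toLp (logSide f)) : Lp ℂ 2 (volume : Measure ℝ)) := by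
    have h3 : (𝓕⁻ (hmem.toLp p' - hh.toLp (logSide f)) : Lp ℂ 2 (volume : Measure ℝ)) =
        𝓕⁻ (hmem.toLp p') - 𝓕⁻ (hh.toLp (logSide f)) :=
      map_sub (Lp.fourierTransformₗᵢ ℝ ℂ).symm _ _
    rw [h3]
    filter_upwards [fourierInv_toLp_ae_eq hmem hint, Lp.coeFn_sub (𝓕⁻ (hmem.toLp p'))
      (𝓕⁻ (hh.toLp (logSide f)))] with x hx1 hx2
    rw [hx2, Pi.sub_apply, hx1]
  rw [eLpNorm_congr_ae h2, ← MemLp.toLp_sub, ← Lp.enorm_def, ← Lp.enorm_toLp (hf := hmem.sub hh)]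
  simp only [← ofReal_norm]
  congr 1
  exact ((Lp.fourierTransformₗᵢ ℝ ℂ).symm.norm_map _).symm

theorem integral_mellinPlancherel_mul {f : ℝ → ℂ}
    (hf : MemLp f 2 (volume.restrict (Ioi (0 : ℝ)))) (η : 𝓢(ℝ, ℂ)) :
    ∫ τ, mellinPlancherel f hf τ * η τ = ∫ v, logSide f v * expTransform η v := by
  have hh := memLp_logSide hf
  -- That is, `θ(w) = η(2πw)`; its inverse Fourier transform carries `1/(2π)`, which cancels the
  -- Jacobian of `τ = 2πw`.
  set θ : 𝓢(ℝ, ℂ) := SchwartzMap.compCLMOfContinuousLinearEquiv ℂ dilation.symm η with hθ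
  have hpi : (2 * Real.pi) ≠ 0 := by positivity
  have hdil : ∀ w, dilation w = w * (2 * Real.pi)⁻¹ := fun w ↦ rfl
  have hdil' : ∀ w, dilation.symm w = w * (2 * Real.pi) := fun w ↦ by
    rw [ContinuousLinearEquiv.symm_apply_eq, hdil, mul_inv_cancel_right₀ hpi]
  have hθa : ∀ w, θ w = η (w * (2 * Real.pi)) := fun w ↦ by rw [← hdil']; rfl
  have hinv : ∀ v, 𝓕⁻ θ v = ((2 * Real.pi : ℝ) : ℂ)⁻¹ * expTransform η v := by
    intro v
    have h := Measure.integral_comp_mul_right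
      (fun τ : ℝ ↦ η τ * Complex.exp (Complex.I * τ * v)) (2 * Real.pi)
    rw [← expTransform_apply, abs_of_pos (by positivity), Complex.real_smul] at h
    rw [← Complex.ofReal_inv, ← h, SchwartzMap.fourierInv_coe, Real.fourierInv_eq']
    congr 1
    ext w
    rw [hθa, smul_eq_mul, mul_comm]
    simp only [RCLike.inner_apply, conj_trivial]
    congr 2
    push_cast
    ring
  have h1 := congrArg (fun T : 𝓢'(ℝ, ℂ) ↦ T θ)
    (Lp.fourierInv_toTemperedDistribution_eq (hh.toLp (logSide f)))
  simp only [TemperedDistribution.fourierInv_apply, Lp.toTemperedDistribution_apply] at h1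
  have h2 : ∫ x, 𝓕⁻ θ x • (hh.toLp (logSide f)) x =
      ((2 * Real.pi : ℝ) : ℂ)⁻¹ * ∫ x, logSide f x * expTransform η x := by
    rw [← integral_const_mul]
    refine integral_congr_ae ?_
    filter_upwards [hh.coeFn_toLp] with x hx
    rw [hx, hinv, smul_eq_mul]
    ring
  have h3 := Measure.integral_comp_mul_right (fun w ↦
    (𝓕⁻ (hh.toLp (logSide f)) : Lp ℂ 2 (volume : Measure ℝ)) w * θ w) (2 * Real.pi)⁻¹
  have h4 : ∀ τ, mellinPlancherel f hf τ * η τ =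
      (𝓕⁻ (hh.toLp (logSide f)) : Lp ℂ 2 (volume : Measure ℝ)) (τ * (2 * Real.pi)⁻¹) *
        θ (τ * (2 * Real.pi)⁻¹) := fun τ ↦ by
    rw [hθa, inv_mul_cancel_right₀ hpi]
    rfl
  simp only [h4]
  rw [h3]
  simp only [smul_eq_mul] at h1
  simp only [mul_comm _ (θ _)]
  rw [← h1]
  simp only [smul_eq_mul] at h2
  rw [h2, inv_inv, abs_of_pos (by positivity), Complex.real_smul, mul_inv_cancel_left₀]
  exact_mod_cast hpi

/-! ### The limiting tempered distribution. -/

theorem memLp_top_fractConv {h : ℝ → ℂ} (hh : MemLp h 2) : MemLp (fractConv h) ⊤ :=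
  memLp_top_of_bound (continuous_fractConv hh).aestronglyMeasurable _
    (Eventually.of_forall (norm_fractConv_le hh))

/-- The tempered distribution `g' - g/2`, for `g = fractConv h`. -/
def sumDistribution (h : ℝ → ℂ) (hh : MemLp h 2) : 𝓢'(ℝ, ℂ) :=
  PointwiseConvergenceCLM.precomp ℂ
    (-(SchwartzMap.derivCLM ℂ ℂ + (1 / 2 : ℂ) • ContinuousLinearMap.id ℂ 𝓢(ℝ, ℂ)))
    (Lp.toTemperedDistribution ((memLp_top_fractConv hh).toLp (fractConv h)))

theorem integrable_deriv_add (ψ : 𝓢(ℝ, ℂ)) : Integrable fun u ↦ deriv ψ u + ψ u / 2 :=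
  (SchwartzMap.derivCLM ℂ ℂ ψ).integrable.add (ψ.integrable.div_const 2)

theorem sumDistribution_apply {h : ℝ → ℂ} (hh : MemLp h 2) (ψ : 𝓢(ℝ, ℂ)) :
    sumDistribution h hh ψ = -∫ u, fractConv h u * (deriv ψ u + ψ u / 2) := by
  have : sumDistribution h hh ψ =
      Lp.toTemperedDistribution ((memLp_top_fractConv hh).toLp (fractConv h))
        (-(SchwartzMap.derivCLM ℂ ℂ + (1 / 2 : ℂ) • ContinuousLinearMap.id ℂ 𝓢(ℝ, ℂ)) ψ) := rfl
  rw [this, Lp.toTemperedDistribution_apply, ← integral_neg]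
  refine integral_congr_ae ?_
  filter_upwards [(memLp_top_fractConv hh).coeFn_toLp] with u hu
  rw [hu]
  simp
  ring

theorem sumDistribution_apply' {h : ℝ → ℂ} (hh : MemLp h 2) (ψ : 𝓢(ℝ, ℂ)) :
    sumDistribution h hh ψ = -∫ v, h v * dualConv (fun u ↦ deriv ψ u + ψ u / 2) v := by
  rw [sumDistribution_apply, integral_fractConv_mul hh (integrable_deriv_add ψ)]

/-- Convergence is tested one `ψ` at a time, where `|h · K(ψ' + ψ/2)|` dominates every truncation.
-/
theorem tendsto_sumDistribution_truncLogSide {f : ℝ → ℂ}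
    (hf : MemLp f 2 (volume.restrict (Ioi (0 : ℝ)))) :
    Tendsto (fun Λ ↦ sumDistribution (truncLogSide f Λ) (memLp_truncLogSide hf Λ)) atTop
      (𝓝 (sumDistribution (logSide f) (memLp_logSide hf))) := by
  rw [PointwiseConvergenceCLM.tendsto_iff_forall_tendsto]
  intro ψ
  simp only [sumDistribution_apply']
  have hi := integrable_mul_dualConv (memLp_logSide hf) (integrable_deriv_add ψ)
  refine (tendsto_integral_filter_of_dominated_convergence _ (Eventually.of_forall fun Λ ↦
    (integrable_mul_dualConv (memLp_truncLogSide hf Λ)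
      (integrable_deriv_add ψ)).aestronglyMeasurable)
    (Eventually.of_forall fun Λ ↦ Eventually.of_forall fun v ↦ ?_) hi.norm
    (Eventually.of_forall fun v ↦ tendsto_const_nhds.congr' ?_)).neg
  · simp only [norm_mul]
    gcongr
    exact norm_indicator_le_norm_self _ _
  · filter_upwards [Real.tendsto_log_atTop.eventually_ge_atTop v] with Λ hΛ
    simp [truncLogSide, hΛ]

theorem isTemperedFun_truncSum {f : ℝ → ℂ} (hf : MemLp f 2 (volume.restrict (Ioi (0 : ℝ))))
    {Λ : ℝ} (hΛ : 0 < Λ) :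
    IsTemperedFun (fun u : ℝ ↦ (Real.exp (u / 2) : ℂ) * truncSum f Λ (Real.exp u))
      (sumDistribution (truncLogSide f Λ) (memLp_truncLogSide hf Λ)) := by
  refine ⟨locallyIntegrable_exp_mul_truncSum hf hΛ, fun ψ hψ ↦ ?_⟩
  rw [sumDistribution_apply', integral_truncSum_mul hf hΛ ((ψ.smooth ⊤).of_le (by simp)) hψ]

theorem isTemperedFun_mellinFourier {f : ℝ → ℂ} (hf : MemLp f 2 (volume.restrict (Ioi (0 : ℝ)))) :
    IsTemperedFun
      (fun τ : ℝ ↦ riemannZeta (1 / 2 + (τ : ℂ) * Complex.I) * mellinPlancherel f hf τ)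
      (mellinFourier (sumDistribution (logSide f) (memLp_logSide hf))) := by
  refine ⟨?_, fun θ hθ ↦ ?_⟩
  · have h1 := (memLp_mellinPlancherel hf).locallyIntegrable (by norm_num)
    rw [← locallyIntegrableOn_univ] at h1 ⊢
    exact h1.continuousOn_mul contDiff_riemannZeta_critical.continuous.continuousOn
      isOpen_univ.isLocallyClosed
  · rw [mellinFourier_apply, sumDistribution_apply']
    simp only [dualConv_expTransform θ hθ, mul_neg, integral_neg, neg_neg]
    rw [← integral_mellinPlancherel_mul hf]
    congr 1
    ext τ
    rw [zetaMul_apply]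
    ring

/-! ### The distribution on the half-line. -/

theorem integrableOn_mul_coSum {f : ℝ → ℂ} (hf : MemLp f 2 (volume.restrict (Ioi (0 : ℝ))))
    (φ : 𝓓(halfLine, ℂ)) : IntegrableOn (fun x : ℝ ↦ f x * coSum φ x) (Ioi 0) := by
  rw [integrableOn_Ioi_zero_iff_exp]
  refine (integrable_mul_dualConv (memLp_logSide hf)
    (integrable_deriv_add (logPullback φ))).neg.congr (Eventually.of_forall fun u ↦ ?_)
  simp only [Pi.neg_apply, ← mul_neg, ← exp_mul_coSum, logSide]
  rw [← add_halves u, Real.exp_add, Complex.ofReal_mul, add_halves]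
  ring

theorem integral_mul_coSum {f : ℝ → ℂ} (hf : MemLp f 2 (volume.restrict (Ioi (0 : ℝ))))
    (φ : 𝓓(halfLine, ℂ)) :
    ∫ x in Ioi (0 : ℝ), f x * coSum φ x =
      sumDistribution (logSide f) (memLp_logSide hf) (logPullback φ) := by
  rw [integral_Ioi_zero_eq_integral_exp, sumDistribution_apply', ← integral_neg]
  congr 1
  ext u
  simp only [← mul_neg, ← exp_mul_coSum, logSide]
  rw [← add_halves u, Real.exp_add, Complex.ofReal_mul, add_halves]
  ring

theorem deriv_id_mul (φ : 𝓓(halfLine, ℂ)) (x : ℝ) :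
    deriv (fun y : ℝ ↦ (y : ℂ) * φ y) x = φ x + x * deriv φ x := by
  have h := (Complex.ofRealCLM.hasDerivAt (x := x)).fun_mul
    (φ.contDiff.differentiable (by simp) x).hasDerivAt
  simpa using h.deriv

theorem deriv_logPullback_add (φ : 𝓓(halfLine, ℂ)) (u : ℝ) :
    deriv (logPullback φ) u + logPullback φ u / 2 =
      (Real.exp (u / 2) : ℂ) * deriv (fun y : ℝ ↦ (y : ℂ) * φ y) (Real.exp u) := by
  have h1 : HasDerivAt (fun u : ℝ ↦ (Real.exp (u / 2) : ℂ)) ((Real.exp (u / 2) * (1 / 2) : ℝ) : ℂ)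
      u := ((hasDerivAt_id u).div_const 2).exp.ofReal_comp
  have h2 := (φ.contDiff.differentiable (by simp) (Real.exp u)).hasDerivAt.scomp u
    (Real.hasDerivAt_exp u)
  have h3 : HasDerivAt (logPullback φ) _ u := h1.mul h2
  rw [h3.deriv, deriv_id_mul, logPullback_apply, Complex.real_smul]
  push_cast
  ring

theorem sumDistribution_logPullback {f : ℝ → ℂ} (hf : MemLp f 2 (volume.restrict (Ioi (0 : ℝ))))
    (φ : 𝓓(halfLine, ℂ)) :
    sumDistribution (logSide f) (memLp_logSide hf) (logPullback φ) =
      -∫ x in Ioi (0 : ℝ), fractIntegral f x * deriv (fun y : ℝ ↦ (y : ℂ) * φ y) x := by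
  rw [sumDistribution_apply, integral_Ioi_zero_eq_integral_exp]
  congr 2
  ext u
  rw [deriv_logPullback_add, ← exp_mul_fractIntegral]
  have e : (Real.exp u : ℂ) = Real.exp (u / 2) * Real.exp (u / 2) := by
    rw [← Complex.ofReal_mul, ← Real.exp_add, add_halves]
  rw [e]
  ring

theorem locallyIntegrableOn_fractIntegral {f : ℝ → ℂ}
    (hf : MemLp f 2 (volume.restrict (Ioi (0 : ℝ)))) :
    LocallyIntegrableOn (fractIntegral f) (Ioi 0) :=
  (continuousOn_fractIntegral hf).locallyIntegrableOn measurableSet_Ioi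

/-- The distribution `x (d/dx) G` on `]0, ∞[`, for `G = fractIntegral f`. -/
def eulerDistribution (f : ℝ → ℂ) : HalfLineDistribution :=
  -(TestFunction.integralAgainstBilinCLM (ContinuousLinearMap.mul ℂ ℂ) volume (fractIntegral f) +
    (TestFunction.integralAgainstBilinCLM (ContinuousLinearMap.mul ℂ ℂ) volume
      fun x : ℝ ↦ (x : ℂ) * fractIntegral f x).comp
      (TestFunction.lineDerivCLM ℂ (1 : ℝ) : 𝓓(halfLine, ℂ) →L[ℂ] 𝓓(halfLine, ℂ)))

/-- Expanding `(xφ)' = φ + xφ'` presents the form through integration against the locally integrable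
`G` and `xG`, which supplies continuity. -/
theorem eulerDistribution_apply {f : ℝ → ℂ} (hf : MemLp f 2 (volume.restrict (Ioi (0 : ℝ))))
    (φ : 𝓓(halfLine, ℂ)) :
    eulerDistribution f φ =
      -∫ x in Ioi (0 : ℝ), fractIntegral f x * deriv (fun y : ℝ ↦ (y : ℂ) * φ y) x := by
  have h1 : LocallyIntegrableOn (fractIntegral f) halfLine := locallyIntegrableOn_fractIntegral hf
  have h2 : LocallyIntegrableOn (fun x : ℝ ↦ (x : ℂ) * fractIntegral f x) halfLine :=
    ((Continuous.continuousOn (by fun_prop)).mul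
      (continuousOn_fractIntegral hf)).locallyIntegrableOn measurableSet_Ioi
  set φ' : 𝓓(halfLine, ℂ) := TestFunction.lineDerivCLM ℂ (1 : ℝ) φ with hφ'
  have hd : ∀ x, φ' x = deriv φ x := fun x ↦ by
    rw [hφ', TestFunction.lineDerivCLM_apply_of_le (by simp),
      (φ.contDiff.differentiable (by simp) x).lineDeriv_eq_fderiv, fderiv_apply_one_eq_deriv]
  have i1 : Integrable fun x ↦ φ x * fractIntegral f x :=
    TestFunction.integrable_bilin (ContinuousLinearMap.mul ℂ ℂ) h1 φ
  have i2 : Integrable fun x ↦ φ' x * ((x : ℂ) * fractIntegral f x) :=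
    TestFunction.integrable_bilin (ContinuousLinearMap.mul ℂ ℂ) h2 φ'
  have hval : eulerDistribution f φ =
      -((∫ x, φ x * fractIntegral f x) + ∫ x : ℝ, φ' x * ((x : ℂ) * fractIntegral f x)) := by
    change -(TestFunction.integralAgainstBilinCLM (ContinuousLinearMap.mul ℂ ℂ) volume
      (fractIntegral f) φ + TestFunction.integralAgainstBilinCLM (ContinuousLinearMap.mul ℂ ℂ)
      volume (fun x : ℝ ↦ (x : ℂ) * fractIntegral f x) φ') = _
    rw [TestFunction.integralAgainstBilinCLM_eq_integral h1,
      TestFunction.integralAgainstBilinCLM_eq_integral h2]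
    simp only [ContinuousLinearMap.mul_apply']
  rw [hval, ← integral_add i1 i2, ← setIntegral_eq_integral_of_forall_compl_eq_zero (s := Ioi 0)]
  · congr 2
    ext x
    rw [deriv_id_mul, hd]
    ring
  · intro x hx
    have e1 : φ x = 0 := image_eq_zero_of_notMem_tsupport fun h ↦ hx (φ.tsupport_subset h)
    have e2 : φ' x = 0 := image_eq_zero_of_notMem_tsupport fun h ↦ hx (φ'.tsupport_subset h)
    simp [e1, e2]

end Muntz

end

theorem mainTheorem7 (f : ℝ → ℂ) (hf : MemLp f 2 (volume.restrict (Ioi (0 : ℝ)))) :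
    ∃ (S : ℝ → 𝓢'(ℝ, ℂ)) (T : 𝓢'(ℝ, ℂ)) (D : Muntz.HalfLineDistribution) (F : ℝ → ℂ),
      -- the functions `√x A_Λ(x)` are tempered distributions `S Λ` in `u = log x` ...
      (∀ Λ : ℝ, 0 < Λ →
        Muntz.IsTemperedFun
          (fun u : ℝ ↦ (Real.exp (u / 2) : ℂ) * Muntz.truncSum f Λ (Real.exp u)) (S Λ)) ∧
      -- ... which converge as `Λ → ∞` to a tempered distribution `T` in `log x` ...
      Tendsto S atTop (𝓝 T) ∧
      -- ... which is `√x D(x)` for a distribution `D` on `]0, ∞[`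
      (∀ φ : 𝓓(Muntz.halfLine, ℂ), D φ = T (Muntz.logPullback φ)) ∧
      -- its Mellin–Fourier transform is `ζ(1/2 + iτ) \hat f(1/2 + iτ)`
      Muntz.IsMellinPlancherel f F ∧
      Muntz.IsTemperedFun (fun τ : ℝ ↦ riemannZeta (1 / 2 + (τ : ℂ) * Complex.I) * F τ)
        (Muntz.mellinFourier T) ∧
      -- `D` is characterised by its pairing with test functions, through co-sums
      (∀ φ : 𝓓(Muntz.halfLine, ℂ),
        IntegrableOn (fun x : ℝ ↦ f x * Muntz.coSum φ x) (Ioi 0) volume) ∧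
      (∀ E : Muntz.HalfLineDistribution, E = D ↔
        ∀ φ : 𝓓(Muntz.halfLine, ℂ), E φ = ∫ x in Ioi (0 : ℝ), f x * Muntz.coSum φ x) ∧
      -- `D(x) = x d/dx ∫_0^∞ f(x u) {u}/u du`
      (∀ x : ℝ, 0 < x →
        IntegrableOn (fun u : ℝ ↦ f (x * u) * ((Int.fract u / u : ℝ) : ℂ)) (Ioi 0) volume) ∧
      Muntz.IsEulerDeriv (Muntz.fractIntegral f) D := by
  refine ⟨fun Λ ↦ Muntz.sumDistribution _ (Muntz.memLp_truncLogSide hf Λ),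
    Muntz.sumDistribution _ (Muntz.memLp_logSide hf), Muntz.eulerDistribution f,
    Muntz.mellinPlancherel f hf, fun Λ hΛ ↦ Muntz.isTemperedFun_truncSum hf hΛ,
    Muntz.tendsto_sumDistribution_truncLogSide hf, fun φ ↦ ?_,
    Muntz.isMellinPlancherel_mellinPlancherel hf, Muntz.isTemperedFun_mellinFourier hf,
    Muntz.integrableOn_mul_coSum hf, fun E ↦ ⟨?_, fun h ↦ ?_⟩,
    fun x hx ↦ Muntz.integrableOn_fractIntegral hf hx,
    Muntz.locallyIntegrableOn_fractIntegral hf, Muntz.eulerDistribution_apply hf⟩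
  · rw [Muntz.eulerDistribution_apply hf, Muntz.sumDistribution_logPullback hf]
  · rintro rfl φ
    rw [Muntz.eulerDistribution_apply hf, Muntz.integral_mul_coSum hf,
      Muntz.sumDistribution_logPullback hf]
  · ext φ
    rw [h, Muntz.eulerDistribution_apply hf, Muntz.integral_mul_coSum hf,
      Muntz.sumDistribution_logPullback hf]
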